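/- Let $m,p,n$ be positive integers with $p\mid m$ and $n>1$, and let $G=G(m,p,n)$ be the group of $n\times n$ monomial matrices whose nonzero entries are $m$-th roots of unity with product an $(m/p)$-th root of unity. It acts on the open unit polydisc $\mathbb D^n$ by $\sigma\cdot z=\sigma^{-1}z$. Put $\theta_i(z)=s_i(z_1^m,\dots,z_n^m)$ for $1\le i\le n-1$, where $s_i$ is the $i$-th elementary symmetric polynomial, and $\theta_n(z)=(z_1\cdots z_n)^{m/p}$. Let $\boldsymbol\theta=(\theta_1,\dots,\theta_n)$ and $\boldsymbol\Theta_n=\boldsymbol\theta(\mathbb D^n)$. A commuting $n$-tuple $T$ of bounded operators on a Hilbert space is a $\boldsymbol\Theta_n$-contraction if $\|f(T)\|\le\sup_{\overline{\boldsymbol\Theta}_n}|f|$ for all $f\in\mathbb C[z_1,\dots,z_n]$. Two tuples $T$, $S$ are unitarily equivalent if there is a unitary $U$ with $UT_k=S_kU$ for all $k$. Let $\mathcal H$ be a (scalar) analytic Hilbert module on $\mathbb D^n$, that is, a reproducing kernel Hilbert space of holomorphic functions on $\mathbb D^n$ on which the polynomials act as bounded operators $M_q$ of pointwise multiplication, and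 which contains $\mathbb C[z_1,\dots,z_n]$ as a dense subspace. Assume that its reproducing kernel $K$ is $G$-invariant, i.e. $K(\sigma\cdot z,\sigma\cdot w)=K(z,w)$. Assume that $\mathcal H\subseteq L^2(\mathbb D^n,\mu)$ as a Hilbert space, i.e. $\|f\|^2=\int_{\mathbb D^n}|f|^2\,d\mu<\infty$ for $f\in\mathcal H$, for some Borel measure $\mu$ on $\mathbb D^n$ that is not carried by a proper real-analytic subset: every real-analytic $u:\mathbb D^n\to\mathbb R$ that vanishes $\mu$-almost everywhere vanishes identically. (This holds for instance if every nonempty open subset of $\mathbb D^n$ has positive $\mu$-measure.) Let $\widehat G$ be the set of equivalence classes of irreducible complex representations of $G$. For each $\varrho\in\widehat G$ fix a representative $\pi_\varrho:G\to U(\deg\varrho)$ by unitary matrices, and for $1\le i\le\deg\varrho$ let $$(\mathbb P_\varrho^{ii}f)(z)=\frac{\deg\varrho}{|G|}\sum_{\sigma\in G}\pi_\varrho^{ii}(\sigma^{-1})f(\sigma^{-1}\cdot z).$$ Then $\widehat G$ is finite and the following hold. Each $\mathbb P_\varrho^{ii}$ maps $\mathcal H$ into itself. The spaces $\mathbb P_\varrho^{ii}\mathcal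 H$ ($\varrho\in\widehat G$, $1\le i\le\deg\varrho$) are nonzero, closed, pairwise distinct and invariant under $M_{\theta_1},\dots,M_{\theta_n}$, and each restricted tuple $T_{\varrho,i}=(M_{\theta_1},\dots,M_{\theta_n})|_{\mathbb P_\varrho^{ii}\mathcal H}$ is a $\boldsymbol\Theta_n$-contraction. The tuples $T_{\varrho,i}$ and $T_{\varrho',j}$ are unitarily equivalent if and only if $\varrho=\varrho'$. Consequently the tuples $T_{\varrho,i}$ fall into precisely $|\widehat G|$ unitary equivalence classes, and the class belonging to $\varrho$ consists of the $\deg\varrho$ tuples $T_{\varrho,1},\dots,T_{\varrho,\deg\varrho}$. -/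

import Mathlib

noncomputable section

namespace ThetaContraction

open MvPolynomial

/-- The open unit polydisc in `ℂⁿ`. -/
def polydisc (n : ℕ) : Set (Fin n → ℂ) := {z | ∀ i, ‖z i‖ < 1}

/-- The open unit polydisc, as a type. -/
abbrev Polydisc (n : ℕ) : Type := polydisc n

/-- `A` is the monomial matrix `(A z) i = c i * z (τ i)`. -/
def IsMonomial {n : ℕ} (A : Matrix (Fin n) (Fin n) ℂ) (τ : Equiv.Perm (Fin n))
    (c : Fin n → ℂˣ) : Prop :=
  ∀ i j, A i j = if j = τ i then (c i : ℂ) else 0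

lemma IsMonomial.mulVec {n : ℕ} {A : Matrix (Fin n) (Fin n) ℂ} {τ : Equiv.Perm (Fin n)}
    {c : Fin n → ℂˣ} (h : IsMonomial A τ c) (z : Fin n → ℂ) (i : Fin n) :
    A.mulVec z i = c i * z (τ i) := by
  unfold IsMonomial at h
  simp [Matrix.mulVec, dotProduct, h]

lemma isMonomial_one (n : ℕ) :
    IsMonomial (1 : Matrix (Fin n) (Fin n) ℂ) 1 (fun _ => 1) := by
  intro i j
  simp [Matrix.one_apply, eq_comm]

lemma IsMonomial.mul {n : ℕ} {A B : Matrix (Fin n) (Fin n) ℂ} {τ τ' : Equiv.Perm (Fin n)}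
    {c c' : Fin n → ℂˣ} (h : IsMonomial A τ c) (h' : IsMonomial B τ' c') :
    IsMonomial (A * B) (τ' * τ) (fun i => c i * c' (τ i)) := by
  intro i j
  unfold IsMonomial at h h'
  rw [Matrix.mul_apply, Finset.sum_eq_single (τ i)]
  · simp [h, h']
    congr
  · intro x _ hx
    simp [h, hx]
  · simp

/-- `G(m,p,n)`: the `n × n` monomial matrices whose nonzero entries are `m`-th roots of unity
with product an `(m/p)`-th root of unity. -/
def reflectionGroup (m p n : ℕ) : Subgroup (GL (Fin n) ℂ) where
  carrier := {A | ∃ (τ : Equiv.Perm (Fin n)) (c : Fin n → ℂˣ),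
    (∀ i, c i ^ m = 1) ∧ (∏ i, c i) ^ (m / p) = 1 ∧
      IsMonomial (A : Matrix (Fin n) (Fin n) ℂ) τ c}
  one_mem' := ⟨1, fun _ => 1, by simp, by simp, by simpa using isMonomial_one n⟩
  mul_mem' := by
    rintro A B ⟨τ, c, h1, h2, h3⟩ ⟨τ', c', h1', h2', h3'⟩
    refine ⟨τ' * τ, fun i => c i * c' (τ i), fun i => ?_, ?_, ?_⟩
    · rw [mul_pow, h1, h1', one_mul]
    · rw [Finset.prod_mul_distrib, Equiv.prod_comp τ c', mul_pow, h2, h2', one_mul]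
    · simpa using h3.mul h3'
  inv_mem' := by
    rintro A ⟨τ, c, h1, h2, h3⟩
    refine ⟨τ⁻¹, fun i => (c (τ⁻¹ i))⁻¹, fun i => ?_, ?_, ?_⟩
    · rw [inv_pow, h1, inv_one]
    · rw [Finset.prod_inv_distrib, Equiv.prod_comp τ⁻¹ c, inv_pow, h2, inv_one]
    · set B : Matrix (Fin n) (Fin n) ℂ :=
        Matrix.of fun i j => if j = τ⁻¹ i then (((c (τ⁻¹ i))⁻¹ : ℂˣ) : ℂ) else 0 with hB
      have hBm : IsMonomial B τ⁻¹ (fun i => (c (τ⁻¹ i))⁻¹) := fun i j => by simp [hB]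
      have hAB : (A : Matrix (Fin n) (Fin n) ℂ) * B = 1 := by
        ext i j
        rw [h3.mul hBm i j, isMonomial_one n i j]
        simp [Equiv.Perm.one_apply]
        congr
      have : ((A⁻¹ : GL (Fin n) ℂ) : Matrix (Fin n) (Fin n) ℂ) = B := by
        calc ((A⁻¹ : GL (Fin n) ℂ) : Matrix (Fin n) (Fin n) ℂ)
            = (A⁻¹ : GL (Fin n) ℂ) * ((A : Matrix (Fin n) (Fin n) ℂ) * B) := by
              rw [hAB, mul_one]
          _ = B := by rw [← mul_assoc, ← Units.val_mul, inv_mul_cancel, Units.val_one, one_mul]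
      rw [this]
      exact hBm

instance (m p n : ℕ) [NeZero m] : Finite (reflectionGroup m p n) := by
  let D := Equiv.Perm (Fin n) × (Fin n → rootsOfUnity m ℂ)
  have key : ∀ A : reflectionGroup m p n, ∃ d : D,
      IsMonomial ((A : GL (Fin n) ℂ) : Matrix (Fin n) (Fin n) ℂ) d.1 (fun i => (d.2 i : ℂˣ)) := by
    rintro ⟨A, τ, c, h1, h2, h3⟩
    exact ⟨⟨τ, fun i => ⟨c i, (mem_rootsOfUnity m (c i)).2 (h1 i)⟩⟩, h3⟩
  choose f hf using key
  refine Finite.of_injective f fun A B hAB => ?_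
  apply Subtype.ext
  apply Units.ext
  ext i j
  rw [hf A i j, hf B i j, hAB]

instance (m p n : ℕ) [NeZero m] : Fintype (reflectionGroup m p n) := Fintype.ofFinite _

lemma mulVec_mem_polydisc {m p n : ℕ} [NeZero m] (σ : reflectionGroup m p n) {z : Fin n → ℂ}
    (hz : z ∈ polydisc n) :
    ((σ : GL (Fin n) ℂ) : Matrix (Fin n) (Fin n) ℂ).mulVec z ∈ polydisc n := by
  obtain ⟨A, τ, c, h1, h2, h3⟩ := σ
  intro i
  have hc : ‖(c i : ℂ)‖ = 1 := by
    refine Complex.norm_eq_one_of_pow_eq_one (n := m) ?_ (NeZero.ne m)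
    rw [← Units.val_pow_eq_pow_val, h1, Units.val_one]
  rw [h3.mulVec, norm_mul, hc, one_mul]
  exact hz _

/-- The action of `G(m,p,n)` on the polydisc, `σ · z = σ⁻¹ z`. -/
def act {m p n : ℕ} [NeZero m] (σ : reflectionGroup m p n) (z : Polydisc n) : Polydisc n :=
  ⟨(((σ⁻¹ : reflectionGroup m p n) : GL (Fin n) ℂ) : Matrix (Fin n) (Fin n) ℂ).mulVec z,
    mulVec_mem_polydisc σ⁻¹ z.2⟩

/-- The basic invariant polynomials of `G(m,p,n)`: with `k` counted from `0`, the entry `k` is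
the elementary symmetric polynomial of degree `k + 1` in `z₁ᵐ, …, zₙᵐ` if `k + 1 < n`, and the
last entry is `(z₁ ⋯ zₙ) ^ (m / p)`. -/
def theta (m p n : ℕ) (k : Fin n) : MvPolynomial (Fin n) ℂ :=
  if (k : ℕ) + 1 < n then expand m (esymm (Fin n) ℂ (k + 1)) else (∏ i, X i) ^ (m / p)

lemma eval_theta_mulVec {m p n : ℕ} (σ : reflectionGroup m p n) (k : Fin n) (z : Fin n → ℂ) :
    eval (((σ : GL (Fin n) ℂ) : Matrix (Fin n) (Fin n) ℂ).mulVec z) (theta m p n k) =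
      eval z (theta m p n k) := by
  obtain ⟨A, τ, c, h1, h2, h3⟩ := σ
  have hv : (A : Matrix (Fin n) (Fin n) ℂ).mulVec z = fun i => (c i : ℂ) * z (τ i) :=
    funext (h3.mulVec z)
  have h1' : ∀ i, (c i : ℂ) ^ m = 1 := fun i => by
    rw [← Units.val_pow_eq_pow_val, h1, Units.val_one]
  have h2' : (∏ i, (c i : ℂ)) ^ (m / p) = 1 := by
    simpa using congrArg Units.val h2
  simp only [hv]
  unfold theta
  split_ifs with hk
  · have hex : ∀ (w : Fin n → ℂ) (f : MvPolynomial (Fin n) ℂ),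
        eval w (expand m f) = eval (fun i => w i ^ m) f := by
      intro w f
      induction f using MvPolynomial.induction_on with
      | C a => simp
      | add f g hf hg => simp [hf, hg]
      | mul_X f i hf => simp [hf]
    rw [hex, hex]
    simp only [mul_pow, h1', one_mul]
    conv_rhs => rw [← rename_esymm (Fin n) ℂ _ τ, eval_rename]
    rfl
  · simp only [map_pow, map_prod, eval_X, Finset.prod_mul_distrib, mul_pow, h2', one_mul]
    rw [Equiv.prod_comp τ z]

/-- The domain `Θₙ = θ(𝔻ⁿ)`. -/
def Theta (m p n : ℕ) : Set (Fin n → ℂ) := (fun z k => eval z (theta m p n k)) '' polydisc n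

section Operators

variable {E F : Type*} [NormedAddCommGroup E] [NormedSpace ℂ E]
  [NormedAddCommGroup F] [NormedSpace ℂ F] {n : ℕ}

/-- The operator `f(T₁, …, Tₙ)` for a commuting tuple `T` and a polynomial `f`. -/
def polyCalc (T : Fin n → (E →L[ℂ] E)) (f : MvPolynomial (Fin n) ℂ) : E →L[ℂ] E :=
  ∑ s ∈ f.support, f.coeff s • (List.ofFn fun i => T i ^ s i).prod

/-- The compact set `X` is a spectral set for the commuting tuple `T`. -/
def IsSpectralSet (X : Set (Fin n → ℂ)) (T : Fin n → (E →L[ℂ] E)) : Prop :=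
  ∀ f : MvPolynomial (Fin n) ℂ, ‖polyCalc T f‖ ≤ sSup ((fun w => ‖eval w f‖) '' X)

/-- A `Θₙ`-contraction: a commuting tuple having the closure of `Θₙ` as a spectral set. -/
def IsThetaContraction (m p : ℕ) (T : Fin n → (E →L[ℂ] E)) : Prop :=
  (∀ i j, Commute (T i) (T j)) ∧ IsSpectralSet (closure (Theta m p n)) T

/-- Unitary equivalence of tuples of operators. -/
def UnitarilyEquivalent (T : Fin n → (E →L[ℂ] E)) (S : Fin n → (F →L[ℂ] F)) : Prop :=
  ∃ U : E ≃ₗᵢ[ℂ] F, ∀ k x, U (T k x) = S k (U x)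

end Operators

/-- An irreducible complex matrix representation of `G`. -/
structure Irrep (G : Type) [Group G] where
  deg : ℕ
  rep : Representation ℂ G (Fin deg → ℂ)
  irreducible : rep.IsIrreducible

/-- The matrix of `π σ`. -/
def Irrep.matrix {G : Type} [Group G] (π : Irrep G) (σ : G) :
    Matrix (Fin π.deg) (Fin π.deg) ℂ :=
  LinearMap.toMatrix' (π.rep σ)

/-- `π` is a unitary representation for the standard inner product. -/
def Irrep.IsUnitary {G : Type} [Group G] (π : Irrep G) : Prop :=
  ∀ σ, π.matrix σ ∈ Matrix.unitaryGroup (Fin π.deg) ℂ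

/-- Equivalence of irreducible representations. -/
instance irrepSetoid (G : Type) [Group G] : Setoid (Irrep G) where
  r π π' := Nonempty (π.rep.Equiv π'.rep)
  iseqv := ⟨fun π => ⟨.refl π.rep⟩, fun ⟨e⟩ => ⟨e.symm⟩, fun ⟨e⟩ ⟨e'⟩ => ⟨e.trans e'⟩⟩

/-- The set of equivalence classes of irreducible representations of `G`. -/
def Dual (G : Type) [Group G] : Type := Quotient (irrepSetoid G)

/-- The class of an irreducible representation. -/
def Irrep.toDual {G : Type} [Group G] (π : Irrep G) : Dual G := Quotient.mk (irrepSetoid G) π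

/-- A (scalar) analytic Hilbert module over `ℂ[z₁, …, zₙ]` on the polydisc: a reproducing kernel
Hilbert space of holomorphic functions on which the polynomials act boundedly by pointwise
multiplication, and which contains the polynomials as a dense subspace. -/
structure AnalyticHilbertModule (n : ℕ) (H : Type*) [NormedAddCommGroup H]
    [InnerProductSpace ℂ H] [CompleteSpace H] [RKHS ℂ H (Polydisc n) ℂ] where
  holomorphic : ∀ f : H, ∃ F : (Fin n → ℂ) → ℂ,
    AnalyticOnNhd ℂ F (polydisc n) ∧ ∀ z : Polydisc n, f z = F z
  mul : MvPolynomial (Fin n) ℂ →ₐ[ℂ] (H →L[ℂ] H)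
  mul_apply : ∀ (q : MvPolynomial (Fin n) ℂ) (f : H) (z : Polydisc n),
    mul q f z = eval (z : Fin n → ℂ) q * f z
  polynomial_mem : ∀ q : MvPolynomial (Fin n) ℂ, ∃ h : H,
    ∀ z : Polydisc n, h z = eval (z : Fin n → ℂ) q
  dense : Dense {h : H | ∃ q : MvPolynomial (Fin n) ℂ,
    ∀ z : Polydisc n, h z = eval (z : Fin n → ℂ) q}

section Isotypic

variable {m p n : ℕ} [NeZero m]

/-- `(ℙ^{ij} f)(z) = (deg π / |G|) ∑_σ π^{ji}(σ⁻¹) f(σ⁻¹ · z)`. -/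
def isotypicMap (π : Irrep (reflectionGroup m p n)) (i j : Fin π.deg) :
    (Polydisc n → ℂ) →ₗ[ℂ] (Polydisc n → ℂ) where
  toFun f z := ((π.deg : ℂ) / (Fintype.card (reflectionGroup m p n) : ℂ)) *
    ∑ σ : reflectionGroup m p n, π.matrix σ⁻¹ j i * f (act σ⁻¹ z)
  map_add' f g := by
    funext z
    simp [mul_add, Finset.sum_add_distrib]
  map_smul' a f := by
    funext z
    simp only [Pi.smul_apply, smul_eq_mul, RingHom.id_apply, Finset.mul_sum]
    exact Finset.sum_congr rfl fun σ _ => by ring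

variable {H : Type*} [NormedAddCommGroup H] [InnerProductSpace ℂ H] [CompleteSpace H]
  [RKHS ℂ H (Polydisc n) ℂ]

variable (H) in
/-- The subspace `ℙ^{ii} H` of `H`. -/
def block (π : Irrep (reflectionGroup m p n)) (i : Fin π.deg) : Submodule ℂ H where
  carrier := {h | ∃ f : H, (h : Polydisc n → ℂ) = isotypicMap π i i f}
  zero_mem' := ⟨0, by simp⟩
  add_mem' := by
    rintro a b ⟨f, hf⟩ ⟨g, hg⟩
    exact ⟨f + g, by simp [hf, hg]⟩
  smul_mem' := by
    rintro c a ⟨f, hf⟩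
    exact ⟨c • f, by simp [hf]⟩

lemma mul_theta_mem_block (A : AnalyticHilbertModule n H)
    (π : Irrep (reflectionGroup m p n)) (i : Fin π.deg) (k : Fin n) :
    Set.MapsTo (A.mul (theta m p n k)) (block H π i) (block H π i) := by
  rintro h ⟨f, hf⟩
  refine ⟨A.mul (theta m p n k) f, ?_⟩
  funext z
  rw [A.mul_apply, hf]
  simp only [isotypicMap, LinearMap.coe_mk, AddHom.coe_mk, A.mul_apply, act, eval_theta_mulVec,
    Finset.mul_sum]
  exact Finset.sum_congr rfl fun σ _ => by ring

/-- The restriction of `(M_{θ₁}, …, M_{θₙ})` to `ℙ^{ii} H`. -/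
def blockTuple (A : AnalyticHilbertModule n H) (π : Irrep (reflectionGroup m p n))
    (i : Fin π.deg) (k : Fin n) : block H π i →L[ℂ] block H π i :=
  (A.mul (theta m p n k)).restrict (mul_theta_mem_block A π i k)

end Isotypic

end ThetaContraction

end

noncomputable section

namespace ThetaContraction

open MvPolynomial

/-! ### Schur orthogonality for matrix coefficients, and finiteness of the dual. -/

section Schur

variable {G : Type} [Group G]

/-! Invariance of the kernel makes f ↦ f ∘ `act σ` a unitary representation of G on H that commutes
with multiplication by each θ_k. By Schur orthogonality the operators ℙ^{ij} satisfy the relations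
of matrix units (`isotypicOp_mul`, `isotypicOp_mul_of_ne`). For unitary representatives each ℙ^{ii}
is an orthogonal projection and ℙ^{ij} is a unitary from block i onto block j intertwining the
tuples. Blocks of one class are therefore equivalent. They are nonzero because G has a free orbit,
on which polynomials interpolate. The contraction property is the sup bound for multiplication
operators on L²(μ).

The substance is inequivalence across classes. Let a unitary intertwiner send f to g. Then ⟨q(θ)f,
r(θ)f⟩ = ⟨q(θ)g, r(θ)g⟩ for all polynomials q, r. After averaging over G, the orbit sums of |f|² and
|g|², taken as densities, push forward under θ to measures with the same moments, hence to the same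
measure. Since θ separates orbits, the orbit sums agree μ-almost everywhere, and everywhere by
real-analyticity (`orbitSum_eq_of_inner_eq`). Polarisation gives ∑ f(σz) conj f(σw) = ∑ g(σz) conj
g(σw). Projecting in z onto the class of g kills the left side, while on the diagonal the right side
is a sum of squares including that of g up to a scalar (`eq_zero_of_orbitSum_eq`). So g = 0, which
is impossible for f ≠ 0. -/

lemma Irrep.matrix_one (π : Irrep G) : π.matrix 1 = 1 := by
  simp [Irrep.matrix, Module.End.one_eq_id]

lemma Irrep.matrix_mul (π : Irrep G) (σ τ : G) : π.matrix (σ * τ) = π.matrix σ * π.matrix τ := by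
  simp [Irrep.matrix, Module.End.mul_eq_comp, LinearMap.toMatrix'_comp]

lemma Irrep.toLin'_matrix (π : Irrep G) (σ : G) : Matrix.toLin' (π.matrix σ) = π.rep σ := by
  simp [Irrep.matrix]

lemma Irrep.deg_pos (π : Irrep G) : 0 < π.deg := by
  rcases Nat.eq_zero_or_pos π.deg with h | h
  · exfalso
    have hs : Subsingleton (Fin π.deg → ℂ) := by rw [h]; infer_instance
    have := π.irreducible
    have hn : Nontrivial (Subrepresentation π.rep) := this.toNontrivial
    obtain ⟨a, b, hab⟩ := hn
    apply hab
    have : a.toSubmodule = b.toSubmodule := Subsingleton.elim _ _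
    exact SetLike.ext fun x => by
      have := SetLike.ext_iff.1 this x
      exact this
  · exact h

lemma Irrep.matrix_inv_apply {π : Irrep G} (h : π.IsUnitary) (σ : G) (i j : Fin π.deg) :
    π.matrix σ⁻¹ i j = star (π.matrix σ j i) := by
  have h1 : π.matrix σ⁻¹ * π.matrix σ = 1 := by rw [← π.matrix_mul, inv_mul_cancel, π.matrix_one]
  have h2 := Matrix.mem_unitaryGroup_iff.1 (h σ)
  have : π.matrix σ⁻¹ = star (π.matrix σ) := by
    calc π.matrix σ⁻¹ = π.matrix σ⁻¹ * (π.matrix σ * star (π.matrix σ)) := by rw [h2, mul_one]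
      _ = _ := by rw [← mul_assoc, h1, one_mul]
  rw [this, Matrix.star_apply]

variable [Fintype G]

/-- The average over the group of a rectangular matrix is an intertwiner. -/
def intertwinerOfMatrix (π π' : Irrep G) (E : Matrix (Fin π.deg) (Fin π'.deg) ℂ) :
    Representation.IntertwiningMap π'.rep π.rep where
  toLinearMap := Matrix.toLin' (∑ σ, π.matrix σ⁻¹ * E * π'.matrix σ)
  isIntertwining' := by
    intro τ
    rw [← π.toLin'_matrix, ← π'.toLin'_matrix, ← Matrix.toLin'_mul, ← Matrix.toLin'_mul]
    congr 1
    rw [eq_comm, Matrix.mul_sum, Matrix.sum_mul, ← Equiv.sum_comp (Equiv.mulRight τ)]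
    refine Finset.sum_congr rfl fun σ _ => ?_
    simp only [Equiv.coe_mulRight, mul_inv_rev, π.matrix_mul, π'.matrix_mul]
    simp only [Matrix.mul_assoc]
    rw [← Matrix.mul_assoc (π.matrix τ) (π.matrix τ⁻¹), ← π.matrix_mul, mul_inv_cancel,
      π.matrix_one, Matrix.one_mul]

lemma sum_matrix_mul_single_mul (π π' : Irrep G) (l a : Fin π.deg) (j i : Fin π'.deg) :
    (∑ σ, π.matrix σ⁻¹ * Matrix.single a j (1 : ℂ) * π'.matrix σ) l i =
      ∑ σ, π'.matrix σ j i * π.matrix σ⁻¹ l a := by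
  rw [Matrix.sum_apply]
  refine Finset.sum_congr rfl fun σ _ => ?_
  rw [Matrix.mul_apply, Finset.sum_eq_single j]
  · simp [mul_comm]
  · intro b _ hb
    simp [hb]
  · simp

/-- The sum is an entry of an averaged elementary matrix, an intertwiner that Schur's lemma forces
to vanish. -/
lemma sum_matrix_mul_matrix_inv_of_ne {π π' : Irrep G} (h : π.toDual ≠ π'.toDual)
    (l a : Fin π.deg) (j i : Fin π'.deg) :
    ∑ σ, π'.matrix σ j i * π.matrix σ⁻¹ l a = 0 := by
  have he : IsEmpty (Representation.Equiv π'.rep π.rep) := by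
    refine ⟨fun e => h ?_⟩
    exact (Quotient.sound (s := irrepSetoid G) (show Nonempty _ from ⟨e⟩)).symm
  have := π.irreducible
  have := π'.irreducible
  have h0 : intertwinerOfMatrix π π' (Matrix.single a j 1) = 0 := Subsingleton.elim _ _
  have h1 : (∑ σ, π.matrix σ⁻¹ * Matrix.single a j (1 : ℂ) * π'.matrix σ) = 0 := by
    apply Matrix.toLin'.injective
    rw [map_zero]
    exact congrArg Representation.IntertwiningMap.toLinearMap h0
  rw [← sum_matrix_mul_single_mul, h1, Matrix.zero_apply]

/-- Over ℂ the averaged elementary matrix is a scalar, and its trace determines the scalar. -/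
lemma sum_matrix_mul_matrix_inv (π : Irrep G) (l a j i : Fin π.deg) :
    ∑ σ, π.matrix σ j i * π.matrix σ⁻¹ l a =
      if j = a ∧ i = l then (Fintype.card G : ℂ) / π.deg else 0 := by
  have := π.irreducible
  obtain ⟨c, hc⟩ := (Representation.IsIrreducible.algebraMap_intertwiningMap_bijective_of_isAlgClosed
    (ρ := π.rep)).2 (intertwinerOfMatrix π π (Matrix.single a j 1))
  set M := ∑ σ, π.matrix σ⁻¹ * Matrix.single a j (1 : ℂ) * π.matrix σ with hM
  have h1 : M = c • 1 := by
    apply Matrix.toLin'.injective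
    have := congrArg Representation.IntertwiningMap.toLinearMap hc.symm
    rw [map_smul, Matrix.toLin'_one]
    refine Eq.trans this ?_
    ext x
    simp [Algebra.algebraMap_eq_smul_one]
  have h2 : M.trace = Fintype.card G * if j = a then 1 else 0 := by
    rw [hM, Matrix.trace_sum]
    have : ∀ σ ∈ (Finset.univ : Finset G),
        (π.matrix σ⁻¹ * Matrix.single a j 1 * π.matrix σ).trace = if j = a then 1 else 0 := by
      intro σ _
      rw [Matrix.trace_mul_comm, ← Matrix.mul_assoc, ← π.matrix_mul, mul_inv_cancel, π.matrix_one,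
        Matrix.one_mul]
      split_ifs with h
      · subst h; simp
      · exact Matrix.trace_single_eq_of_ne _ _ _ (Ne.symm h)
    rw [Finset.sum_congr rfl this]
    simp
  have hd : (π.deg : ℂ) ≠ 0 := by exact_mod_cast π.deg_pos.ne'
  have h3 : c = (Fintype.card G * if j = a then 1 else 0) / π.deg := by
    rw [eq_div_iff hd, ← h2, h1]
    simp [Matrix.trace_smul]
  rw [← sum_matrix_mul_single_mul, ← hM, h1, Matrix.smul_apply, Matrix.one_apply, h3]
  by_cases h' : i = l
  · by_cases h : j = a <;> simp [h, h']
  · simp [h', Ne.symm h']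

/-- A finite group has finitely many classes of irreducible representations. -/
lemma finite_dual : Finite (Dual G) := by
  classical
  let P : Dual G → Irrep G := fun ϱ => Quotient.out ϱ
  have hP : ∀ ϱ, (P ϱ).toDual = ϱ := fun ϱ => Quotient.out_eq ϱ
  let z : ∀ ϱ, Fin (P ϱ).deg := fun ϱ => ⟨0, (P ϱ).deg_pos⟩
  -- One diagonal coefficient per class gives orthogonal functions in the finite-dimensional space
  -- ℂ^G.
  have hli : LinearIndependent ℂ (fun (ϱ : Dual G) (σ : G) => (P ϱ).matrix σ (z ϱ) (z ϱ)) := by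
    rw [linearIndependent_iff']
    intro s c hc ϱ hϱ
    have h1 : ∑ σ, (∑ x ∈ s, c x • fun σ : G => (P x).matrix σ (z x) (z x)) σ *
        (P ϱ).matrix σ⁻¹ (z ϱ) (z ϱ) = 0 := by
      rw [hc]; simp
    simp only [Finset.sum_apply, Pi.smul_apply, smul_eq_mul, Finset.sum_mul] at h1
    rw [Finset.sum_comm, Finset.sum_eq_single ϱ] at h1
    · simp only [mul_assoc, ← Finset.mul_sum, sum_matrix_mul_matrix_inv] at h1
      have hd : ((P ϱ).deg : ℂ) ≠ 0 := by exact_mod_cast (P ϱ).deg_pos.ne'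
      simpa [hd] using h1
    · intro x _ hx
      simp only [mul_assoc, ← Finset.mul_sum]
      rw [sum_matrix_mul_matrix_inv_of_ne, mul_zero]
      rw [hP, hP]
      exact hx.symm
    · exact fun h => (h hϱ).elim
  exact hli.finite

end Schur

/-! ### The action on the polydisc, a free orbit, and polynomial interpolation. -/

section Action

variable {m p n : ℕ} [NeZero m]

/-- The order is reversed, so that σ ↦ (f ↦ f ∘ `act σ`) is a homomorphism. -/
lemma act_act (σ τ : reflectionGroup m p n) (z : Polydisc n) :
    act σ (act τ z) = act (τ * σ) z := by
  apply Subtype.ext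
  simp [act, Matrix.mulVec_mulVec]

lemma act_one (z : Polydisc n) : act (1 : reflectionGroup m p n) z = z := by
  apply Subtype.ext
  simp [act]

lemma eval_theta_act (σ : reflectionGroup m p n) (k : Fin n) (z : Polydisc n) :
    eval (act σ z : Fin n → ℂ) (theta m p n k) = eval (z : Fin n → ℂ) (theta m p n k) :=
  eval_theta_mulVec σ⁻¹ k z

lemma norm_coeff_eq_one {c : Fin n → ℂˣ} (h : ∀ i, c i ^ m = 1) (i : Fin n) :
    ‖(c i : ℂ)‖ = 1 := by
  refine Complex.norm_eq_one_of_pow_eq_one (n := m) ?_ (NeZero.ne m)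
  rw [← Units.val_pow_eq_pow_val, h, Units.val_one]

/-- A point of the polydisc whose coordinates are nonzero and have distinct moduli. -/
def regularPoint (n : ℕ) : Polydisc n :=
  ⟨fun i => ((((i : ℕ) : ℝ) + 2)⁻¹ : ℝ), fun i => by
    rw [Complex.norm_real, Real.norm_of_nonneg (by positivity)]
    exact inv_lt_one_of_one_lt₀ (by linarith [(Nat.cast_nonneg (i : ℕ) : (0 : ℝ) ≤ _)])⟩

/-- Matrix entries have modulus 0 or 1, so distinct moduli force the trivial permutation, and
nonzero coordinates then force trivial coefficients. -/
lemma eq_one_of_act_regularPoint {σ : reflectionGroup m p n}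
    (h : act σ (regularPoint n) = regularPoint n) : σ = 1 := by
  rw [← inv_eq_one]
  have h' := congrArg Subtype.val h
  simp only [act] at h'
  generalize σ⁻¹ = σ' at h' ⊢
  obtain ⟨A, τ, c, h1, h2, h3⟩ := σ'
  have h4 : ∀ i, (c i : ℂ) * (regularPoint n : Fin n → ℂ) (τ i) =
      (regularPoint n : Fin n → ℂ) i := fun i => by
    rw [← h3.mulVec]; exact congrFun h' i
  have h5 : ∀ i, τ i = i := by
    intro i
    have := congrArg norm (h4 i)
    rw [norm_mul, norm_coeff_eq_one h1, one_mul] at this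
    simp only [regularPoint, Complex.norm_real] at this
    rw [Real.norm_of_nonneg (by positivity), Real.norm_of_nonneg (by positivity), inv_inj] at this
    apply Fin.ext
    exact_mod_cast add_right_cancel this
  have h6 : ∀ i, c i = 1 := by
    intro i
    have := h4 i
    rw [h5] at this
    apply Units.ext
    refine mul_right_cancel₀ (b := (regularPoint n : Fin n → ℂ) i) ?_ (by simpa using this)
    simp only [regularPoint]
    norm_cast
    positivity
  apply Subtype.ext
  apply Units.ext
  ext i j
  rw [show ((⟨A, τ, c, h1, h2, h3⟩ : reflectionGroup m p n) : GL (Fin n) ℂ) = A from rfl, h3 i j,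
    h5, h6]
  simp [Matrix.one_apply, eq_comm]

/-- A polynomial separating a point from a finite set. -/
lemma exists_eval_eq_one_of_notMem (S : Finset (Fin n → ℂ)) {z : Fin n → ℂ} (hz : z ∉ S) :
    ∃ q : MvPolynomial (Fin n) ℂ, eval z q = 1 ∧ ∀ w ∈ S, eval w q = 0 := by
  have h : ∀ w : S, ∃ i, z i ≠ (w : Fin n → ℂ) i := fun w => by
    by_contra! hc
    exact hz (by rw [funext hc]; exact w.2)
  choose i hi using h
  refine ⟨∏ w : S, C (z (i w) - (w : Fin n → ℂ) (i w))⁻¹ *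
    (X (i w) - C ((w : Fin n → ℂ) (i w))), ?_, fun w hw => ?_⟩
  · rw [map_prod]
    refine Finset.prod_eq_one fun w _ => ?_
    simp [inv_mul_cancel₀ (sub_ne_zero.2 (hi w))]
  · rw [map_prod]
    exact Finset.prod_eq_zero (Finset.mem_univ (⟨w, hw⟩ : S)) (by simp)

end Action

/-! ### The unitary action on H, the matrix units ℙ^{ij}, and the blocks. -/

section Composition

variable {m p n : ℕ} [NeZero m]
variable {H : Type*} [NormedAddCommGroup H] [InnerProductSpace ℂ H] [CompleteSpace H]
  [RKHS ℂ H (Polydisc n) ℂ]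

/-- A symmetry of the kernel of a reproducing kernel Hilbert space acts by composition. -/
lemma exists_comp_of_kernel_invariant {X : Type*} {H : Type*} [NormedAddCommGroup H]
    [InnerProductSpace ℂ H] [CompleteSpace H] [RKHS ℂ H X ℂ] (φ : X → X)
    (hφ : ∀ z w, RKHS.kernel H (φ z) (φ w) = RKHS.kernel H z w) (f : H) :
    ∃ h : H, (∀ z, h z = f (φ z)) ∧ ‖h‖ ≤ ‖f‖ := by
  -- The assignment k_x ↦ k_{φ x} preserves inner products and so extends from the dense span of
  -- kernel functions; the adjoint of the extension is composition with φ.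
  let a : (X →₀ ℂ) →ₗ[ℂ] H := Finsupp.linearCombination ℂ fun x => RKHS.kerFun H x (1 : ℂ)
  let b : (X →₀ ℂ) →ₗ[ℂ] H := Finsupp.linearCombination ℂ fun x => RKHS.kerFun H (φ x) (1 : ℂ)
  have hab : ∀ c d, inner ℂ (b c) (b d) = inner ℂ (a c) (a d) := by
    intro c d
    simp only [a, b, Finsupp.linearCombination_apply, Finsupp.sum_inner, Finsupp.inner_sum,
      inner_smul_right, inner_smul_left, ← RKHS.kernel_inner, hφ]
  have hnorm : ∀ c, ‖b c‖ ≤ 1 * ‖a c‖ := by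
    intro c
    rw [one_mul, @norm_eq_sqrt_re_inner ℂ, @norm_eq_sqrt_re_inner ℂ _ _ _ _ (a c), hab]
  have hdense : DenseRange a := by
    rw [DenseRange, ← LinearMap.coe_range, Submodule.dense_iff_topologicalClosure_eq_top,
      eq_top_iff, ← RKHS.kerFun_dense H (𝕜 := ℂ)]
    refine Submodule.topologicalClosure_mono (Submodule.span_le.2 ?_)
    rintro _ ⟨x, v, rfl⟩
    refine ⟨Finsupp.single x v, ?_⟩
    simp [a, ← map_smul]
  let W : H →L[ℂ] H := b.extendOfNorm a
  have hW : ∀ x, W (RKHS.kerFun H x (1 : ℂ)) = RKHS.kerFun H (φ x) (1 : ℂ) := by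
    intro x
    have := LinearMap.extendOfNorm_eq hdense ⟨1, hnorm⟩ (Finsupp.single x 1)
    simpa [a, b] using this
  have hWn : ‖W‖ ≤ 1 := LinearMap.opNorm_extendOfNorm_le hdense zero_le_one hnorm
  refine ⟨ContinuousLinearMap.adjoint W f, fun z => ?_, ?_⟩
  · have h1 := RKHS.kerFun_inner z (1 : ℂ) (ContinuousLinearMap.adjoint W f)
    rw [ContinuousLinearMap.adjoint_inner_right, hW, RKHS.kerFun_inner] at h1
    simpa using h1.symm
  · refine (ContinuousLinearMap.le_opNorm _ _).trans ?_
    rw [LinearIsometryEquiv.norm_map]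
    exact mul_le_of_le_one_left (norm_nonneg _) hWn

variable (hK : ∀ (σ : reflectionGroup m p n) (z w : Polydisc n),
  RKHS.kernel H (act σ z) (act σ w) = RKHS.kernel H z w)

/-- The function `f ∘ act σ`, as an element of `H`. -/
def compFun (σ : reflectionGroup m p n) (f : H) : H :=
  (exists_comp_of_kernel_invariant (act σ) (hK σ) f).choose

lemma compFun_apply (σ : reflectionGroup m p n) (f : H) (z : Polydisc n) :
    compFun hK σ f z = f (act σ z) :=
  (exists_comp_of_kernel_invariant (act σ) (hK σ) f).choose_spec.1 z

/-- The operator `f ↦ f ∘ act σ`. -/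
def compOp (σ : reflectionGroup m p n) : H →L[ℂ] H :=
  LinearMap.mkContinuous
    { toFun := compFun hK σ
      map_add' := fun f g => RKHS.ext fun z => by simp [compFun_apply]
      map_smul' := fun c f => RKHS.ext fun z => by simp [compFun_apply] } 1
    fun f => by
      rw [one_mul]
      exact (exists_comp_of_kernel_invariant (act σ) (hK σ) f).choose_spec.2

lemma compOp_apply (σ : reflectionGroup m p n) (f : H) (z : Polydisc n) :
    compOp hK σ f z = f (act σ z) :=
  compFun_apply hK σ f z

lemma compOp_mul (σ τ : reflectionGroup m p n) :
    compOp hK (σ * τ) = compOp hK σ * compOp hK τ := by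
  refine ContinuousLinearMap.ext fun f => RKHS.ext fun z => ?_
  simp [compOp_apply, act_act]

lemma compOp_one : compOp hK (1 : reflectionGroup m p n) = 1 := by
  refine ContinuousLinearMap.ext fun f => RKHS.ext fun z => ?_
  simp [compOp_apply, act_one]

lemma norm_compOp_apply_le (σ : reflectionGroup m p n) (f : H) : ‖compOp hK σ f‖ ≤ ‖f‖ :=
  (exists_comp_of_kernel_invariant (act σ) (hK σ) f).choose_spec.2

lemma norm_compOp_apply (σ : reflectionGroup m p n) (f : H) : ‖compOp hK σ f‖ = ‖f‖ := by
  refine le_antisymm (norm_compOp_apply_le hK σ f) ?_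
  have := norm_compOp_apply_le hK σ⁻¹ (compOp hK σ f)
  rwa [← mul_apply_eq_comp, ← compOp_mul, inv_mul_cancel, compOp_one,
    one_apply_eq_self] at this

lemma inner_compOp_compOp (σ : reflectionGroup m p n) (f g : H) :
    inner ℂ (compOp hK σ f) (compOp hK σ g) = inner ℂ f g :=
  LinearIsometry.inner_map_map ⟨(compOp hK σ).toLinearMap, norm_compOp_apply hK σ⟩ f g

lemma inner_compOp_left (σ : reflectionGroup m p n) (f g : H) :
    inner ℂ (compOp hK σ f) g = inner ℂ f (compOp hK σ⁻¹ g) := by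
  rw [← inner_compOp_compOp hK σ f, ← mul_apply_eq_comp (compOp hK σ), ← compOp_mul,
    mul_inv_cancel, compOp_one, one_apply_eq_self]

lemma compOp_mul_theta (A : AnalyticHilbertModule n H) (σ : reflectionGroup m p n) (k : Fin n)
    (f : H) :
    compOp hK σ (A.mul (theta m p n k) f) = A.mul (theta m p n k) (compOp hK σ f) := by
  apply RKHS.ext
  intro z
  rw [compOp_apply, A.mul_apply, A.mul_apply, compOp_apply, eval_theta_act]

/-- The operator on `H` induced by `ℙ^{ij}`. -/
def isotypicOp (π : Irrep (reflectionGroup m p n)) (i j : Fin π.deg) : H →L[ℂ] H :=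
  ((π.deg : ℂ) / (Fintype.card (reflectionGroup m p n) : ℂ)) •
    ∑ σ, π.matrix σ j i • compOp hK σ

lemma isotypicOp_apply (π : Irrep (reflectionGroup m p n)) (i j : Fin π.deg) (f : H)
    (z : Polydisc n) :
    isotypicOp hK π i j f z = ((π.deg : ℂ) / (Fintype.card (reflectionGroup m p n) : ℂ)) *
      ∑ σ, π.matrix σ j i * f (act σ z) := by
  have hsum : ∀ (s : Finset (reflectionGroup m p n)) (F : reflectionGroup m p n → H),
      (∑ σ ∈ s, F σ) z = ∑ σ ∈ s, F σ z := fun s F => by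
    have := map_sum (RKHS.coeCLM (H := H) ℂ) F s
    have h2 := congrFun this z
    rw [Finset.sum_apply] at h2
    exact h2
  simp [isotypicOp, hsum, compOp_apply]

lemma coe_isotypicOp (π : Irrep (reflectionGroup m p n)) (i j : Fin π.deg) (f : H) :
    (isotypicOp hK π i j f : Polydisc n → ℂ) = isotypicMap π i j f := by
  funext z
  rw [isotypicOp_apply, ← Equiv.sum_comp (Equiv.inv _)]
  rfl

lemma sum_smul_compOp_mul (a b : reflectionGroup m p n → ℂ) :
    (∑ σ, a σ • compOp hK σ) * (∑ τ, b τ • compOp hK τ) =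
      ∑ ρ, (∑ σ, a σ * b (σ⁻¹ * ρ)) • compOp hK ρ := by
  simp only [Finset.sum_mul, Finset.sum_smul]
  rw [Finset.sum_comm]
  refine Finset.sum_congr rfl fun σ _ => ?_
  rw [Finset.mul_sum, ← Equiv.sum_comp (Equiv.mulLeft σ⁻¹)]
  refine Finset.sum_congr rfl fun ρ _ => ?_
  rw [smul_mul_smul_comm, ← compOp_mul]
  simp

lemma isotypicOp_mul_of_ne {π π' : Irrep (reflectionGroup m p n)} (h : π.toDual ≠ π'.toDual)
    (i j : Fin π.deg) (k l : Fin π'.deg) :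
    isotypicOp hK π i j * isotypicOp hK π' k l = 0 := by
  rw [isotypicOp, isotypicOp, smul_mul_smul_comm, sum_smul_compOp_mul]
  refine smul_eq_zero_of_right _ (Finset.sum_eq_zero fun ρ _ => ?_)
  simp only [π'.matrix_mul, Matrix.mul_apply, Finset.mul_sum]
  rw [Finset.sum_comm, Finset.sum_eq_zero, zero_smul]
  intro a _
  simp only [← mul_assoc, ← Finset.sum_mul]
  rw [sum_matrix_mul_matrix_inv_of_ne h.symm, zero_mul]

/-- Composing the operators convolves their coefficients, and Schur orthogonality evaluates the
convolution. Here ℙ^{ij} maps block i to block j. -/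
lemma isotypicOp_mul (π : Irrep (reflectionGroup m p n)) (i j k l : Fin π.deg) :
    isotypicOp hK π i j * isotypicOp hK π k l = if i = l then isotypicOp hK π k j else 0 := by
  have hd : (π.deg : ℂ) ≠ 0 := by exact_mod_cast π.deg_pos.ne'
  have hG : (Fintype.card (reflectionGroup m p n) : ℂ) ≠ 0 := by
    exact_mod_cast Fintype.card_ne_zero
  have key : ∀ ρ, ∑ σ, π.matrix σ j i * π.matrix (σ⁻¹ * ρ) l k =
      if i = l then (Fintype.card (reflectionGroup m p n) : ℂ) / π.deg * π.matrix ρ j k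
        else 0 := by
    intro ρ
    simp only [π.matrix_mul, Matrix.mul_apply, Finset.mul_sum]
    rw [Finset.sum_comm]
    simp only [← mul_assoc, ← Finset.sum_mul, sum_matrix_mul_matrix_inv]
    by_cases h : i = l <;> simp [h]
  rw [isotypicOp, isotypicOp, smul_mul_smul_comm, sum_smul_compOp_mul]
  simp only [key]
  split_ifs with h
  · simp only [mul_smul, ← Finset.smul_sum, isotypicOp]
    simp only [smul_smul]
    congr 1
    field_simp
  · simp

lemma inner_isotypicOp_left {π : Irrep (reflectionGroup m p n)} (hu : π.IsUnitary)
    (i j : Fin π.deg) (f g : H) :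
    inner ℂ (isotypicOp hK π i j f) g = inner ℂ f (isotypicOp hK π j i g) := by
  simp only [isotypicOp, smul_apply, sum_apply,
    inner_smul_left, inner_smul_right, sum_inner, inner_sum]
  congr 1
  · simp
  · rw [← Equiv.sum_comp (Equiv.inv _)]
    refine Finset.sum_congr rfl fun σ _ => ?_
    rw [inner_compOp_left, Equiv.inv_apply, inv_inv, Irrep.matrix_inv_apply hu]
    simp

lemma isotypicOp_mul_theta (A : AnalyticHilbertModule n H) (π : Irrep (reflectionGroup m p n))
    (i j : Fin π.deg) (k : Fin n) (f : H) :
    isotypicOp hK π i j (A.mul (theta m p n k) f) =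
      A.mul (theta m p n k) (isotypicOp hK π i j f) := by
  simp [isotypicOp, compOp_mul_theta]

lemma isotypicOp_mem_block (π : Irrep (reflectionGroup m p n)) (i j : Fin π.deg) (f : H) :
    isotypicOp hK π i j f ∈ block H π j := by
  refine ⟨isotypicOp hK π i j f, ?_⟩
  rw [← coe_isotypicOp hK, ← mul_apply_eq_comp, isotypicOp_mul, if_pos rfl]

/-- The range of an idempotent is its fixed space; closedness and disjointness of the blocks rest on
this. -/
lemma mem_block_iff (π : Irrep (reflectionGroup m p n)) (i : Fin π.deg) (h : H) :
    h ∈ block H π i ↔ isotypicOp hK π i i h = h := by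
  constructor
  · rintro ⟨f, hf⟩
    rw [← coe_isotypicOp hK] at hf
    rw [DFunLike.coe_injective hf, ← mul_apply_eq_comp, isotypicOp_mul, if_pos rfl]
  · intro hh
    rw [← hh]
    exact isotypicOp_mem_block hK π i i h

include hK in
lemma isClosed_block (π : Irrep (reflectionGroup m p n)) (i : Fin π.deg) :
    IsClosed (block H π i : Set H) := by
  have : (block H π i : Set H) = {h | isotypicOp hK π i i h = h} := by
    ext h
    exact mem_block_iff hK π i h
  rw [this]
  exact isClosed_eq (ContinuousLinearMap.continuous _) continuous_id

include hK in
-- Take a polynomial equal to 1 at the regular point and 0 on the rest of its free orbit. Only the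
-- identity contributes to its average there, which is deg π / |G|.
lemma block_ne_bot (A : AnalyticHilbertModule n H) (π : Irrep (reflectionGroup m p n))
    (i : Fin π.deg) : block H π i ≠ ⊥ := by
  classical
  obtain ⟨q, hq1, hq0⟩ := exists_eval_eq_one_of_notMem
    ((Finset.univ.erase (1 : reflectionGroup m p n)).image
      fun σ => (act σ (regularPoint n) : Fin n → ℂ)) (z := regularPoint n) (by
        rw [Finset.mem_image]
        rintro ⟨σ, hσ, h⟩
        exact (Finset.mem_erase.1 hσ).1 (eq_one_of_act_regularPoint (Subtype.ext h)))
  obtain ⟨f, hf⟩ := A.polynomial_mem q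
  intro hb
  have h0 : isotypicOp hK π i i f = 0 := by
    have := isotypicOp_mem_block hK π i i f
    rwa [hb, Submodule.mem_bot] at this
  have h1 := isotypicOp_apply hK π i i f (regularPoint n)
  rw [h0, Finset.sum_eq_single 1, act_one, hf, hq1, π.matrix_one] at h1
  · have hd : (π.deg : ℂ) ≠ 0 := by exact_mod_cast π.deg_pos.ne'
    have hG : (Fintype.card (reflectionGroup m p n) : ℂ) ≠ 0 := by
      exact_mod_cast Fintype.card_ne_zero
    refine div_ne_zero hd hG ?_
    simpa using h1.symm
  · intro σ _ hσ
    rw [hf, hq0, mul_zero]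
    exact Finset.mem_image_of_mem _ (Finset.mem_erase.2 ⟨hσ, Finset.mem_univ _⟩)
  · simp

include hK in
lemma disjoint_block_of_ne {π π' : Irrep (reflectionGroup m p n)} (h : π.toDual ≠ π'.toDual)
    (i : Fin π.deg) (j : Fin π'.deg) : Disjoint (block H π i) (block H π' j) := by
  rw [Submodule.disjoint_def]
  intro x hx hx'
  rw [mem_block_iff hK] at hx hx'
  rw [← hx, ← hx', ← mul_apply_eq_comp, isotypicOp_mul_of_ne hK h,
    zero_apply]

include hK in
lemma disjoint_block_of_index_ne (π : Irrep (reflectionGroup m p n)) {i j : Fin π.deg}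
    (h : i ≠ j) : Disjoint (block H π i) (block H π j) := by
  rw [Submodule.disjoint_def]
  intro x hx hx'
  rw [mem_block_iff hK] at hx hx'
  rw [← hx, ← hx', ← mul_apply_eq_comp, isotypicOp_mul, if_neg h,
    zero_apply]

include hK in
-- The unitary is ℙ^{ij}; its inverse and its adjoint are both ℙ^{ji}.
lemma unitarilyEquivalent_blockTuple (A : AnalyticHilbertModule n H)
    {π : Irrep (reflectionGroup m p n)} (hu : π.IsUnitary) (i j : Fin π.deg) :
    UnitarilyEquivalent (blockTuple A π i) (blockTuple A π j) := by
  have hinv : ∀ (i j : Fin π.deg) (x : block H π i),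
      isotypicOp hK π j i (isotypicOp hK π i j (x : H)) = x := fun i j x => by
    rw [← mul_apply_eq_comp, isotypicOp_mul, if_pos rfl]
    exact (mem_block_iff hK π i x).1 x.2
  let e : block H π i ≃ₗ[ℂ] block H π j :=
    { toFun := fun x => ⟨isotypicOp hK π i j x, isotypicOp_mem_block hK π i j x⟩
      invFun := fun x => ⟨isotypicOp hK π j i x, isotypicOp_mem_block hK π j i x⟩
      map_add' := fun x y => by ext; simp
      map_smul' := fun c x => by ext; simp
      left_inv := fun x => Subtype.ext (hinv i j x)
      right_inv := fun x => Subtype.ext (hinv j i x) }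
  refine ⟨⟨e, fun x => ?_⟩, fun k x => ?_⟩
  · change ‖isotypicOp hK π i j (x : H)‖ = ‖(x : H)‖
    rw [@norm_eq_sqrt_re_inner ℂ, @norm_eq_sqrt_re_inner ℂ _ _ _ _ (x : H),
      inner_isotypicOp_left hK hu, hinv]
  · exact Subtype.ext (isotypicOp_mul_theta hK A π i j k x)

end Composition

/-! ### Sesquiholomorphic functions that vanish on the diagonal. -/

section Polarisation

open ComplexConjugate

/-- Real differentiation in direction v gives v·A + conj v·B = 0; the choices v = 1 and v = i
isolate A. -/
lemma sum_deriv_mul_conj_eq_zero {ι : Type*} [Fintype ι] {U : Set ℂ} (hU : IsOpen U)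
    {f g : ι → ℂ → ℂ} (hf : ∀ a, DifferentiableOn ℂ (f a) U)
    (hg : ∀ a, DifferentiableOn ℂ (g a) U)
    (h : ∀ t ∈ U, ∑ a, f a t * conj (g a t) = 0) :
    ∀ t ∈ U, ∑ a, deriv (f a) t * conj (g a t) = 0 := by
  intro t ht
  have key : ∀ v : ℂ, v * (∑ a, deriv (f a) t * conj (g a t)) +
      conj v * ∑ a, f a t * conj (deriv (g a) t) = 0 := by
    intro v
    have hl : HasDerivAt (fun s : ℝ => t + (s : ℂ) * v) v 0 := by
      simpa using ((Complex.ofRealCLM.hasDerivAt (x := (0 : ℝ))).mul_const v).const_add t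
    have hcomp : ∀ {k : ℂ → ℂ}, DifferentiableOn ℂ k U →
        HasDerivAt (fun s : ℝ => k (t + (s : ℂ) * v)) (v * deriv k t) 0 := by
      intro k hk
      have h1 : HasDerivAt k (deriv k t) (t + ((0 : ℝ) : ℂ) * v) := by
        simpa using ((hk t ht).differentiableAt (hU.mem_nhds ht)).hasDerivAt
      exact h1.scomp (0 : ℝ) hl
    have h1 : HasDerivAt (fun s : ℝ => ∑ a, f a (t + (s : ℂ) * v) * conj (g a (t + (s : ℂ) * v)))
        (∑ a, (v * deriv (f a) t * conj (g a (t + ((0 : ℝ) : ℂ) * v)) +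
          f a (t + ((0 : ℝ) : ℂ) * v) * conj (v * deriv (g a) t))) 0 :=
      HasDerivAt.fun_sum fun a _ => (hcomp (hf a)).mul (hcomp (hg a)).star
    have h2 : (fun s : ℝ => ∑ a, f a (t + (s : ℂ) * v) * conj (g a (t + (s : ℂ) * v)))
        =ᶠ[nhds 0] fun _ => 0 := by
      have : ∀ᶠ s : ℝ in nhds 0, t + (s : ℂ) * v ∈ U := by
        refine hl.continuousAt.eventually_mem ?_
        simpa using hU.mem_nhds ht
      exact this.mono fun s hs => h _ hs
    have h3 := h1.unique ((hasDerivAt_const (0 : ℝ) (0 : ℂ)).congr_of_eventuallyEq h2)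
    rw [← h3, Finset.mul_sum, Finset.mul_sum, ← Finset.sum_add_distrib]
    refine Finset.sum_congr rfl fun a _ => ?_
    simp only [Complex.ofReal_zero, zero_mul, add_zero, map_mul]
    ring
  have e1 := key 1
  have e2 := key Complex.I
  simp only [map_one, one_mul, Complex.conj_I] at e1 e2
  have : 2 * Complex.I * (∑ a, deriv (f a) t * conj (g a t)) = 0 := by
    linear_combination Complex.I * e1 + e2
  simpa using this

/-- Vanishing on the diagonal survives replacing f by its derivative, so the induction runs over all
f with g fixed. -/
lemma iteratedDeriv_sum_mul_conj_eq_zero {ι : Type*} [Fintype ι] {U : Set ℂ} (hU : IsOpen U)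
    {g : ι → ℂ → ℂ} (hg : ∀ a, DifferentiableOn ℂ (g a) U) {t₀ : ℂ} (ht₀ : t₀ ∈ U) (k : ℕ) :
    ∀ f : ι → ℂ → ℂ, (∀ a, DifferentiableOn ℂ (f a) U) →
      (∀ t ∈ U, ∑ a, f a t * conj (g a t) = 0) →
      iteratedDeriv k (fun s => ∑ a, f a s * conj (g a t₀)) t₀ = 0 := by
  induction k with
  | zero => intro f _ h; simpa using h t₀ ht₀
  | succ k ih =>
    intro f hf h
    rw [iteratedDeriv_succ']
    have h1 : deriv (fun s => ∑ a, f a s * conj (g a t₀)) =ᶠ[nhds t₀]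
        fun s => ∑ a, deriv (f a) s * conj (g a t₀) := by
      filter_upwards [hU.mem_nhds ht₀] with s hs
      exact (HasDerivAt.fun_sum fun a _ =>
        (((hf a s hs).differentiableAt (hU.mem_nhds hs)).hasDerivAt).mul_const _).deriv
    rw [h1.iteratedDeriv_eq]
    exact ih _ (fun a => (hf a).deriv hU) (sum_deriv_mul_conj_eq_zero hU hf hg h)

/-- A sesquiholomorphic function of one variable vanishing on the diagonal vanishes. -/
lemma sum_mul_conj_eq_zero_of_diagonal {ι : Type*} [Fintype ι] {U : Set ℂ} (hU : IsOpen U)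
    (hc : IsPreconnected U) {f g : ι → ℂ → ℂ} (hf : ∀ a, DifferentiableOn ℂ (f a) U)
    (hg : ∀ a, DifferentiableOn ℂ (g a) U)
    (h : ∀ t ∈ U, ∑ a, f a t * conj (g a t) = 0) {s t : ℂ} (hs : s ∈ U) (ht : t ∈ U) :
    ∑ a, f a s * conj (g a t) = 0 := by
  have hd : DifferentiableOn ℂ (fun s => ∑ a, f a s * conj (g a t)) U :=
    DifferentiableOn.fun_sum fun a _ => (hf a).mul_const _
  refine (hd.analyticOnNhd hU).eqOn_zero_of_preconnected_of_eventuallyEq_zero hc ht ?_ hs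
  obtain ⟨r, hr, hrU⟩ := Metric.isOpen_iff.1 hU t ht
  filter_upwards [Metric.ball_mem_nhds t hr] with z hz
  have := Complex.taylorSeries_eq_on_ball (hd.mono hrU) hz
  rw [← this]
  simp [iteratedDeriv_sum_mul_conj_eq_zero hU hg ht _ f hf h]

lemma isOpen_polydisc (n : ℕ) : IsOpen (polydisc n) := by
  have : polydisc n = ⋂ i, {z | ‖z i‖ < 1} := by ext z; simp [polydisc]
  rw [this]
  exact isOpen_iInter_of_finite fun i => isOpen_lt (by fun_prop) continuous_const

lemma convex_polydisc (n : ℕ) : Convex ℝ (polydisc n) := by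
  have : polydisc n = Set.pi Set.univ fun _ => Metric.ball (0 : ℂ) 1 := by
    ext z; simp [polydisc]
  rw [this]
  exact convex_pi fun i _ => convex_ball _ _

/-- A sesquiholomorphic function on the polydisc vanishing on the diagonal vanishes. -/
lemma sum_mul_conj_eq_zero_of_diagonal_polydisc {n : ℕ} {ι : Type*} [Fintype ι]
    {F G : ι → (Fin n → ℂ) → ℂ} (hF : ∀ a, DifferentiableOn ℂ (F a) (polydisc n))
    (hG : ∀ a, DifferentiableOn ℂ (G a) (polydisc n))
    (h : ∀ z ∈ polydisc n, ∑ a, F a z * conj (G a z) = 0) {z w : Fin n → ℂ}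
    (hz : z ∈ polydisc n) (hw : w ∈ polydisc n) : ∑ a, F a z * conj (G a w) = 0 := by
  -- Restriction to the complex line through w (t = 0) and z (t = 1) reduces the claim to one
  -- variable.
  let l : ℂ → (Fin n → ℂ) := fun t => w + t • (z - w)
  have hl : Differentiable ℂ l := by
    simp only [l]
    fun_prop
  have hU : IsOpen (l ⁻¹' polydisc n) := (isOpen_polydisc n).preimage hl.continuous
  have hconv : Convex ℝ (l ⁻¹' polydisc n) := by
    intro x hx y hy a b ha hb hab
    have : l (a • x + b • y) = a • l x + b • l y := by
      funext i
      have hab' : (a : ℂ) + b = 1 := by exact_mod_cast hab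
      simp only [l, Pi.add_apply, Pi.smul_apply, Pi.sub_apply, smul_eq_mul, Complex.real_smul]
      linear_combination (-w i) * hab'
    rw [Set.mem_preimage, this]
    exact convex_polydisc n hx hy ha hb hab
  have := sum_mul_conj_eq_zero_of_diagonal (f := fun a => F a ∘ l) (g := fun a => G a ∘ l)
    hU hconv.isPreconnected (fun a => (hF a).comp hl.differentiableOn fun _ h => h)
    (fun a => (hG a).comp hl.differentiableOn fun _ h => h) (fun t ht => h _ ht)
    (s := 1) (t := 0) (by simpa [l] using hz) (by simpa [l] using hw)
  simpa [l] using this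

end Polarisation

/-! ### The map θ separates the orbits of G. -/

section Orbits

lemma exists_perm_of_map_univ_eq {ι α : Type*} [Fintype ι] {a b : ι → α}
    (h : Finset.univ.val.map a = Finset.univ.val.map b) : ∃ τ : Equiv.Perm ι, ∀ i, a (τ i) = b i := by
  classical
  have hcard : ∀ c, Fintype.card {i // b i = c} = Fintype.card {i // a i = c} := by
    intro c
    have := congrArg (Multiset.count c) h
    simp only [Multiset.count_map] at this
    rw [Fintype.card_subtype, Fintype.card_subtype]
    simpa [Finset.card_def, eq_comm] using this.symm
  exact ⟨Equiv.ofFiberEquiv fun c => Fintype.equivOfCardEq (hcard c), fun i =>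
    Equiv.ofFiberEquiv_map _ i⟩

/-- Up to sign these values are the coefficients of ∏ (X - a_i), whose roots recover the multiset.
-/
lemma map_univ_eq_of_eval_esymm_eq {n : ℕ} {a b : Fin n → ℂ}
    (h : ∀ k ≤ n, eval a (esymm (Fin n) ℂ k) = eval b (esymm (Fin n) ℂ k)) :
    Finset.univ.val.map a = Finset.univ.val.map b := by
  rw [← Polynomial.roots_multiset_prod_X_sub_C (Finset.univ.val.map a),
    ← Polynomial.roots_multiset_prod_X_sub_C (Finset.univ.val.map b)]
  congr 1
  rw [Multiset.prod_X_sub_X_eq_sum_esymm, Multiset.prod_X_sub_X_eq_sum_esymm]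
  simp only [Multiset.card_map, Finset.card_val, Finset.card_univ, Fintype.card_fin]
  refine Finset.sum_congr rfl fun k hk => ?_
  have := h k (Finset.mem_range_succ_iff.1 hk)
  rw [← coe_aeval_eq_eval, ← coe_aeval_eq_eval] at this
  rw [← aeval_esymm_eq_multiset_esymm (Fin n) ℂ k a, ← aeval_esymm_eq_multiset_esymm (Fin n) ℂ k b]
  simp only [RingHom.coe_coe] at this
  rw [this]

lemma exists_mem_reflectionGroup {m p n : ℕ} (τ : Equiv.Perm (Fin n)) (c : Fin n → ℂˣ)
    (hc : ∀ i, c i ^ m = 1) (hprod : (∏ i, c i) ^ (m / p) = 1) :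
    ∃ σ : reflectionGroup m p n,
      ∀ (z : Fin n → ℂ) i, ((σ : GL (Fin n) ℂ) : Matrix (Fin n) (Fin n) ℂ).mulVec z i =
        c i * z (τ i) := by
  let A : Matrix (Fin n) (Fin n) ℂ := Matrix.of fun i j => if j = τ i then (c i : ℂ) else 0
  have hA : IsMonomial A τ c := fun i j => rfl
  let B : Matrix (Fin n) (Fin n) ℂ :=
    Matrix.of fun i j => if j = τ⁻¹ i then (((c (τ⁻¹ i))⁻¹ : ℂˣ) : ℂ) else 0
  have hB : IsMonomial B τ⁻¹ (fun i => (c (τ⁻¹ i))⁻¹) := fun i j => rfl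
  have hAB : A * B = 1 := by
    ext i j
    rw [hA.mul hB i j, isMonomial_one n i j]
    simp [Equiv.Perm.one_apply]
    congr
  refine ⟨⟨⟨A, B, hAB, mul_eq_one_comm.1 hAB⟩, τ, c, hc, hprod, hA⟩, fun z i => hA.mulVec z i⟩

/-- The basic invariants separate the orbits. -/
lemma exists_act_eq_of_eval_theta_eq {m p n : ℕ} [NeZero m] (hpm : p ∣ m) {z w : Polydisc n}
    (h : ∀ k, eval (z : Fin n → ℂ) (theta m p n k) = eval (w : Fin n → ℂ) (theta m p n k)) :
    ∃ σ : reflectionGroup m p n, act σ z = w := by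
  classical
  obtain ⟨z, hz⟩ := z
  obtain ⟨w, hw⟩ := w
  simp only at h
  have hlast : ∀ (v : Fin n → ℂ) (k : Fin n), (k : ℕ) + 1 = n →
      eval v (theta m p n k) = (∏ i, v i) ^ (m / p) := by
    intro v k hk
    rw [theta, if_neg (by omega)]
    simp
  have hprod : (∏ i, z i) ^ (m / p) = (∏ i, w i) ^ (m / p) := by
    rcases n with _ | n
    · simp
    · have := h (Fin.last n)
      rwa [hlast _ _ (by simp), hlast _ _ (by simp)] at this
  have hes : ∀ k ≤ n, eval (z ^ m) (esymm (Fin n) ℂ k) = eval (w ^ m) (esymm (Fin n) ℂ k) := by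
    intro k hk
    rcases Nat.eq_zero_or_pos k with rfl | hk0
    · simp
    rcases hk.lt_or_eq with hk | rfl
    · have := h ⟨k - 1, by omega⟩
      rw [theta, if_pos (by simp only; omega), eval_expand, eval_expand] at this
      simpa [Nat.sub_add_cancel hk0] using this
    · have hev : ∀ v : Fin k → ℂ, eval (v ^ m) (esymm (Fin k) ℂ k) = (∏ i, v i) ^ m := by
        intro v
        have hu : Finset.powersetCard k (Finset.univ : Finset (Fin k)) = {Finset.univ} := by
          simpa using Finset.powersetCard_self (Finset.univ : Finset (Fin k))
        rw [esymm, hu]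
        simp [Finset.prod_pow]
      -- The top symmetric polynomial is not among the θ_k, but it is the p-th power of the last
      -- one.
      rw [hev, hev, ← Nat.div_mul_cancel hpm, pow_mul, pow_mul, hprod]
  obtain ⟨τ, hτ⟩ := exists_perm_of_map_univ_eq (map_univ_eq_of_eval_esymm_eq hes)
  simp only [Pi.pow_apply] at hτ
  have hm : m ≠ 0 := NeZero.ne m
  have hzero : ∀ i, z (τ i) = 0 → w i = 0 := fun i hi => by
    have := hτ i
    rw [hi, zero_pow hm] at this
    exact pow_eq_zero_iff hm |>.1 this.symm
  have hex : ∀ i, ∃ c : ℂˣ, c ^ m = 1 ∧ (c : ℂ) * z (τ i) = w i := by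
    intro i
    by_cases hi : z (τ i) = 0
    · exact ⟨1, one_pow m, by simp [hi, hzero i hi]⟩
    · have hwi : w i ≠ 0 := fun hwi => by
        have := hτ i
        rw [hwi, zero_pow hm] at this
        exact hi (pow_eq_zero_iff hm |>.1 this)
      refine ⟨Units.mk0 (w i / z (τ i)) (div_ne_zero hwi hi), ?_, ?_⟩
      · apply Units.ext
        rw [Units.val_pow_eq_pow_val, Units.val_mk0, div_pow, hτ, Units.val_one,
          div_self (pow_ne_zero m hwi)]
      · rw [Units.val_mk0, div_mul_cancel₀ _ hi]
  choose c hcm hcz using hex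
  have hfin : ∃ c' : Fin n → ℂˣ, (∀ i, c' i ^ m = 1) ∧ (∏ i, c' i) ^ (m / p) = 1 ∧
      ∀ i, (c' i : ℂ) * z (τ i) = w i := by
    by_cases hall : ∀ i, z (τ i) ≠ 0
    -- With all coordinates nonzero, the last invariant forces the condition on the product of the
    -- coefficients.
    · refine ⟨c, hcm, ?_, hcz⟩
      have h1 : (∏ i, (c i : ℂ)) * ∏ i, z i = ∏ i, w i := by
        rw [← Equiv.prod_comp τ z, ← Finset.prod_mul_distrib]
        exact Finset.prod_congr rfl fun i _ => hcz i
      have h2 : (∏ i, z i) ≠ 0 := by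
        rw [← Equiv.prod_comp τ z]
        exact Finset.prod_ne_zero_iff.2 fun i _ => hall i
      apply Units.ext
      rw [← h1, mul_pow] at hprod
      have := mul_right_cancel₀ (pow_ne_zero (m / p) h2)
        ((one_mul _).trans hprod)
      rw [Units.val_pow_eq_pow_val, Units.coe_prod, ← this, Units.val_one]
    · push Not at hall
      obtain ⟨i₀, hi₀⟩ := hall
      -- The coefficient facing a zero coordinate is free, and is adjusted to make the product 1.
      refine ⟨Function.update c i₀ (c i₀ * (∏ i, c i)⁻¹), fun i => ?_, ?_, fun i => ?_⟩
      · by_cases hi : i = i₀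
        · subst hi
          rw [Function.update_self, mul_pow, hcm, inv_pow, ← Finset.prod_pow]
          simp [hcm]
        · rw [Function.update_of_ne hi, hcm]
      · rw [Finset.prod_update_of_mem (Finset.mem_univ _), mul_right_comm,
          ← Finset.erase_eq, Finset.mul_prod_erase _ _ (Finset.mem_univ _), mul_inv_cancel,
          one_pow]
      · by_cases hi : i = i₀
        · subst hi
          rw [hi₀, mul_zero, hzero i hi₀]
        · rw [Function.update_of_ne hi, hcz]
  obtain ⟨c', h1, h2, h3⟩ := hfin
  obtain ⟨σ, hσ⟩ := exists_mem_reflectionGroup (p := p) τ c' h1 h2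
  refine ⟨σ⁻¹, Subtype.ext (funext fun i => ?_)⟩
  simp only [act, inv_inv]
  rw [hσ, h3]

end Orbits

/-! ### Densities on the polydisc determined by moments in θ. -/

section Moments

open MeasureTheory ComplexConjugate

/-- Finite measures on a compact subset of `ℂⁿ` are determined by their moments. -/
lemma measure_ext_of_moments {n : ℕ} {K : Set (Fin n → ℂ)} (hK : IsCompact K) {P P' : Measure K}
    [IsFiniteMeasure P] [IsFiniteMeasure P']
    (h : ∀ q r : MvPolynomial (Fin n) ℂ,
      ∫ x : K, eval (x : Fin n → ℂ) q * conj (eval (x : Fin n → ℂ) r) ∂P =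
        ∫ x : K, eval (x : Fin n → ℂ) q * conj (eval (x : Fin n → ℂ) r) ∂P') : P = P' := by
  have : CompactSpace K := isCompact_iff_compactSpace.1 hK
  let coord : Fin n → BoundedContinuousFunction K ℂ := fun k =>
    BoundedContinuousFunction.mkOfCompact
      ⟨fun x => (x : Fin n → ℂ) k, (continuous_apply k).comp continuous_subtype_val⟩
  let A : StarSubalgebra ℂ (BoundedContinuousFunction K ℂ) :=
    StarAlgebra.adjoin ℂ (Set.range coord)
  -- Stone–Weierstrass: the star subalgebra generated by the coordinates separates points and is
  -- spanned by products q · conj r.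
  refine ext_of_forall_mem_subalgebra_integral_eq_of_polish (A := A) ?_ fun g hg => ?_
  · intro x y hxy
    obtain ⟨k, hk⟩ : ∃ k, (x : Fin n → ℂ) k ≠ (y : Fin n → ℂ) k := by
      by_contra! hc
      exact hxy (Subtype.ext (funext hc))
    exact ⟨_, ⟨_, ⟨coord k, StarAlgebra.subset_adjoin ℂ _ ⟨k, rfl⟩, rfl⟩, rfl⟩, hk⟩
  · have hg' : g ∈ Submodule.span ℂ
        (Submonoid.closure (Set.range coord ∪ star (Set.range coord)) : Set _) := by
      rw [← Algebra.adjoin_eq_span, ← StarAlgebra.adjoin_toSubalgebra]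
      exact hg
    clear hg
    induction hg' using Submodule.span_induction with
    | mem g hg =>
      have hqr : ∃ q r : MvPolynomial (Fin n) ℂ,
          ∀ x : K, g x = eval (x : Fin n → ℂ) q * conj (eval (x : Fin n → ℂ) r) := by
        induction hg using Submonoid.closure_induction with
        | mem g hg =>
          rcases hg with ⟨k, rfl⟩ | hg
          · exact ⟨X k, 1, fun x => by simp [coord]⟩
          · obtain ⟨k, hk⟩ := Set.mem_star.1 hg
            refine ⟨1, X k, fun x => ?_⟩
            rw [← star_star g, ← hk]
            simp [coord]
        | one => exact ⟨1, 1, fun x => by simp⟩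
        | mul g g' _ _ hg hg' =>
          obtain ⟨q, r, hqr⟩ := hg
          obtain ⟨q', r', hqr'⟩ := hg'
          refine ⟨q * q', r * r', fun x => ?_⟩
          simp only [BoundedContinuousFunction.mul_apply, hqr, hqr', map_mul]
          ring
      obtain ⟨q, r, hqr⟩ := hqr
      simp only [hqr]
      exact h q r
    | zero => simp
    | add g g' _ _ hg hg' =>
      simp only [BoundedContinuousFunction.add_apply]
      rw [integral_add (g.integrable _) (g'.integrable _),
        integral_add (g.integrable _) (g'.integrable _)]
      exact congrArg₂ (· + ·) hg hg'
    | smul c g _ hg =>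
      simp only [BoundedContinuousFunction.smul_apply]
      rw [integral_smul, integral_smul]
      exact congrArg (c • ·) hg

lemma isCompact_closure_Theta (m p n : ℕ) : IsCompact (closure (Theta m p n)) := by
  have h1 : IsCompact (Set.pi Set.univ fun _ : Fin n => Metric.closedBall (0 : ℂ) 1) :=
    isCompact_univ_pi fun _ => isCompact_closedBall _ _
  have h2 : Continuous fun (z : Fin n → ℂ) k => eval z (theta m p n k) :=
    continuous_pi fun k => (theta m p n k).continuous_eval
  refine (h1.image h2).closure_of_subset (Set.image_mono fun z hz => ?_)
  exact fun i _ => by simpa using (hz i).le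

/-- The map `θ` from the polydisc to the closure of its image. -/
def thetaMap (m p n : ℕ) (z : Polydisc n) : closure (Theta m p n) :=
  ⟨fun k => eval (z : Fin n → ℂ) (theta m p n k), subset_closure ⟨z, z.2, rfl⟩⟩

lemma continuous_thetaMap (m p n : ℕ) : Continuous (thetaMap m p n) :=
  Continuous.subtype_mk (continuous_pi fun k =>
    (theta m p n k).continuous_eval.comp continuous_subtype_val) _

/-- The measures a·μ and b·μ have the same image under θ. The set {b < a} is a union of orbits,
hence a θ-preimage, so both give it equal mass and it is μ-null. -/
lemma ae_le_of_moments {m p n : ℕ} [NeZero m] (hpm : p ∣ m) {μ : Measure (Polydisc n)}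
    {a b : Polydisc n → ℝ} (ha : Continuous a) (hb : Continuous b) (ha0 : ∀ z, 0 ≤ a z)
    (hb0 : ∀ z, 0 ≤ b z) (hai : Integrable a μ) (hbi : Integrable b μ)
    (hainv : ∀ (σ : reflectionGroup m p n) z, a (act σ z) = a z)
    (hbinv : ∀ (σ : reflectionGroup m p n) z, b (act σ z) = b z)
    (h : ∀ q r : MvPolynomial (Fin n) ℂ,
      ∫ z, (a z : ℂ) * (eval (thetaMap m p n z : Fin n → ℂ) q *
        conj (eval (thetaMap m p n z : Fin n → ℂ) r)) ∂μ =
      ∫ z, (b z : ℂ) * (eval (thetaMap m p n z : Fin n → ℂ) q *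
        conj (eval (thetaMap m p n z : Fin n → ℂ) r)) ∂μ) :
    ∀ᵐ z ∂μ, a z ≤ b z := by
  have hθ := continuous_thetaMap m p n
  let P : (Polydisc n → ℝ) → Measure (closure (Theta m p n)) := fun a =>
    (μ.withDensity fun z => ENNReal.ofReal (a z)).map (thetaMap m p n)
  have hfin : ∀ {a : Polydisc n → ℝ}, Integrable a μ → IsFiniteMeasure (P a) := fun {a} hi => by
    have := isFiniteMeasure_withDensity_ofReal hi.2
    infer_instance
  have hint : ∀ {a : Polydisc n → ℝ}, Continuous a → (∀ z, 0 ≤ a z) →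
      ∀ g : (Fin n → ℂ) → ℂ, Continuous g → ∫ x, g x ∂(P a) =
        ∫ z, (a z : ℂ) * g (thetaMap m p n z) ∂μ := by
    intro a ha ha0 g hg
    rw [integral_map (f := fun x : closure (Theta m p n) => g x) hθ.measurable.aemeasurable
      (hg.comp continuous_subtype_val).aestronglyMeasurable,
      integral_withDensity_eq_integral_toReal_smul (f := fun z => ENNReal.ofReal (a z))
        ha.measurable.ennreal_ofReal (by simp)]
    refine integral_congr_ae (Filter.Eventually.of_forall fun z => ?_)
    simp [ENNReal.toReal_ofReal (ha0 z)]
  have hPa := hfin hai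
  have hPb := hfin hbi
  have hP : P a = P b := by
    refine measure_ext_of_moments (isCompact_closure_Theta m p n) fun q r => ?_
    have hc : Continuous fun x : Fin n → ℂ => eval x q * conj (eval x r) :=
      q.continuous_eval.mul (Complex.continuous_conj.comp r.continuous_eval)
    rw [hint ha ha0 _ hc, hint hb hb0 _ hc]
    exact h q r
  set S : Set (Polydisc n) := {z | b z < a z} with hS
  have hSo : IsOpen S := isOpen_lt hb ha
  have hsat : thetaMap m p n ⁻¹' (thetaMap m p n '' S) = S := by
    refine Set.Subset.antisymm ?_ (Set.subset_preimage_image _ _)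
    rintro w ⟨z, hz, hzw⟩
    obtain ⟨σ, rfl⟩ := exists_act_eq_of_eval_theta_eq hpm (z := z) (w := w)
      fun k => congrFun (congrArg Subtype.val hzw) k
    simpa [hS, hainv, hbinv] using hz
  -- An open subset of the polydisc is σ-compact, so its continuous image is a countable union of
  -- compact sets.
  have hmeas : MeasurableSet (thetaMap m p n '' S) := by
    have : LocallyCompactSpace (Polydisc n) := (isOpen_polydisc n).locallyCompactSpace
    have : LocallyCompactSpace S := hSo.locallyCompactSpace
    have hσ : IsSigmaCompact S := isSigmaCompact_iff_sigmaCompactSpace.2 inferInstance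
    obtain ⟨C, hC, hCu⟩ := hσ.image hθ
    rw [← hCu]
    exact MeasurableSet.iUnion fun i => (hC i).measurableSet
  have hSi : ∀ {a : Polydisc n → ℝ}, Integrable a μ → (∀ z, 0 ≤ a z) →
      P a (thetaMap m p n '' S) = ENNReal.ofReal (∫ z in S, a z ∂μ) := by
    intro a hi ha0
    rw [Measure.map_apply hθ.measurable hmeas, hsat, withDensity_apply _ hSo.measurableSet,
      ofReal_integral_eq_lintegral_ofReal hi.integrableOn (Filter.Eventually.of_forall ha0)]
  have heq : ∫ z in S, a z ∂μ = ∫ z in S, b z ∂μ := by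
    have := hSi hai ha0
    rw [hP, hSi hbi hb0] at this
    exact ((ENNReal.ofReal_eq_ofReal_iff (integral_nonneg hb0) (integral_nonneg ha0)).1 this).symm
  have hdiff : ∫ z in S, (a z - b z) ∂μ = 0 := by
    rw [integral_sub hai.integrableOn hbi.integrableOn, heq, sub_self]
  rw [setIntegral_eq_zero_iff_of_nonneg_ae
    ((ae_restrict_iff' hSo.measurableSet).2 (Filter.Eventually.of_forall fun z hz =>
      sub_nonneg.2 (le_of_lt hz))) (hai.sub hbi).integrableOn] at hdiff
  filter_upwards [(ae_restrict_iff' hSo.measurableSet).1 hdiff] with z hz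
  by_contra hlt
  have h1 : z ∈ S := not_le.1 hlt
  have h2 : a z - b z = 0 := hz h1
  exact absurd (not_le.1 hlt) (by linarith)

end Moments

open MeasureTheory ComplexConjugate

/-! ### Intertwiners respect the polynomial calculus. -/

section Calculus

variable {E F : Type*} [NormedAddCommGroup E] [NormedSpace ℂ E]
  [NormedAddCommGroup F] [NormedSpace ℂ F] {n : ℕ}

lemma map_polyCalc {T : Fin n → (E →L[ℂ] E)} {S : Fin n → (F →L[ℂ] F)} (W : E →ₗ[ℂ] F)
    (h : ∀ k x, W (T k x) = S k (W x)) (f : MvPolynomial (Fin n) ℂ) (x : E) :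
    W (polyCalc T f x) = polyCalc S f (W x) := by
  have hpow : ∀ k (e : ℕ) x, W ((T k ^ e) x) = (S k ^ e) (W x) := by
    intro k e
    induction e with
    | zero => intro x; simp
    | succ e ih => intro x; rw [pow_succ, pow_succ, mul_apply_eq_comp, mul_apply_eq_comp, ih, h]
  have hlist : ∀ (s : Fin n →₀ ℕ) (L : List (Fin n)) x,
      W ((L.map fun i => T i ^ s i).prod x) = (L.map fun i => S i ^ s i).prod (W x) := by
    intro s L
    induction L with
    | nil => intro x; simp
    | cons i L ih => 
      intro x
      rw [List.map_cons, List.map_cons, List.prod_cons, List.prod_cons, mul_apply_eq_comp,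
        mul_apply_eq_comp, hpow, ih]
  simp only [polyCalc, List.ofFn_eq_map]
  simp [hlist]

end Calculus

/-! ### Inner products as integrals, and q(M_θ) as multiplication by q ∘ θ. -/

section Multiplication

variable {m p n : ℕ} {H : Type*} [NormedAddCommGroup H] [InnerProductSpace ℂ H]
  [RKHS ℂ H (Polydisc n) ℂ]

/-- Equality of norms makes H → L²(μ) a linear isometry, which preserves inner products. -/
lemma inner_eq_integral {μ : Measure (Polydisc n)}
    (hL2 : ∀ f : H, MemLp (fun z : Polydisc n => f z) 2 μ)
    (hnorm : ∀ f : H, ‖f‖ ^ 2 = ∫ z, ‖f z‖ ^ 2 ∂μ) (f g : H) :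
    inner ℂ f g = ∫ z, g z * conj (f z) ∂μ := by
  let J : H →ₗ[ℂ] Lp ℂ 2 μ :=
    { toFun := fun f => (hL2 f).toLp _
      map_add' := fun f g => by
        rw [← MemLp.toLp_add]
        congr
        simp
        rfl
      map_smul' := fun c f => by
        rw [RingHom.id_apply, ← MemLp.toLp_const_smul]
        congr
        simp
        rfl }
  have hJ : ∀ f g : H, inner ℂ (J f) (J g) = ∫ z, g z * conj (f z) ∂μ := by
    intro f g
    rw [L2.inner_def]
    refine integral_congr_ae ?_
    filter_upwards [(hL2 f).coeFn_toLp, (hL2 g).coeFn_toLp] with z h1 h2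
    change inner ℂ ((hL2 f).toLp _ z) ((hL2 g).toLp _ z) = _
    rw [h1, h2]
    simp
  have hJn : ∀ f, ‖J f‖ = ‖f‖ := by
    intro f
    have h1 : ((‖J f‖ ^ 2 : ℝ) : ℂ) = ((‖f‖ ^ 2 : ℝ) : ℂ) := by
      rw [hnorm f, ← integral_complex_ofReal, Complex.ofReal_pow]
      rw [← RCLike.ofReal_eq_complex_ofReal, ← inner_self_eq_norm_sq_to_K (𝕜 := ℂ), hJ]
      refine integral_congr_ae (Filter.Eventually.of_forall fun z => ?_)
      simp [Complex.mul_conj, Complex.normSq_eq_norm_sq]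
    exact (sq_eq_sq₀ (norm_nonneg _) (norm_nonneg _)).1 (by exact_mod_cast h1)
  rw [← hJ f g]
  exact (LinearIsometry.inner_map_map (⟨J, hJn⟩ : H →ₗᵢ[ℂ] Lp ℂ 2 μ) f g).symm

lemma polyCalc_mul_apply [CompleteSpace H] (A : AnalyticHilbertModule n H)
    (f : MvPolynomial (Fin n) ℂ) (x : H) (z : Polydisc n) :
    polyCalc (fun k => A.mul (theta m p n k)) f x z =
      eval (thetaMap m p n z : Fin n → ℂ) f * x z := by
  have h : polyCalc (fun k => A.mul (theta m p n k)) f = A.mul (bind₁ (theta m p n) f) := by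
    rw [bind₁, aeval_def, eval₂_eq', map_sum]
    refine Finset.sum_congr rfl fun s _ => ?_
    rw [map_mul, AlgHom.commutes, Algebra.smul_def, ← List.prod_ofFn, map_list_prod,
      List.map_ofFn]
    simp only [Function.comp_def, map_pow]
  rw [h, A.mul_apply]
  congr 1
  rw [← coe_aeval_eq_eval, RingHom.coe_coe, aeval_bind₁]
  rfl

end Multiplication

/-! ### The restricted tuples are Θₙ-contractions. -/

section Module

variable {m p n : ℕ} [NeZero m]
variable {H : Type*} [NormedAddCommGroup H] [InnerProductSpace ℂ H] [CompleteSpace H]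
  [RKHS ℂ H (Polydisc n) ℂ]

lemma blockTuple_apply_coe (A : AnalyticHilbertModule n H) (π : Irrep (reflectionGroup m p n))
    (i : Fin π.deg) (f : MvPolynomial (Fin n) ℂ) (x : block H π i) :
    (polyCalc (blockTuple A π i) f x : H) = polyCalc (fun k => A.mul (theta m p n k)) f x :=
  map_polyCalc (block H π i).subtype (fun _ _ => rfl) f x

lemma isThetaContraction_blockTuple (A : AnalyticHilbertModule n H) {μ : Measure (Polydisc n)}
    (hL2 : ∀ f : H, MemLp (fun z : Polydisc n => f z) 2 μ)
    (hnorm : ∀ f : H, ‖f‖ ^ 2 = ∫ z, ‖f z‖ ^ 2 ∂μ) (π : Irrep (reflectionGroup m p n))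
    (i : Fin π.deg) : IsThetaContraction m p (blockTuple A π i) := by
  refine ⟨fun k l => ?_, fun f => ?_⟩
  · refine ContinuousLinearMap.ext fun x => Subtype.ext ?_
    change A.mul (theta m p n k) (A.mul (theta m p n l) x) =
      A.mul (theta m p n l) (A.mul (theta m p n k) x)
    rw [← mul_apply_eq_comp, ← mul_apply_eq_comp, ← map_mul, ← map_mul, mul_comm]
  · set s := sSup ((fun w => ‖eval w f‖) '' closure (Theta m p n)) with hs
    have hs0 : 0 ≤ s := Real.sSup_nonneg (by rintro _ ⟨w, _, rfl⟩; exact norm_nonneg _)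
    -- Compactness of the closure bounds the set, so that `sSup` is a genuine supremum and not the
    -- default 0.
    have hle : ∀ z : Polydisc n, ‖eval (thetaMap m p n z : Fin n → ℂ) f‖ ≤ s := fun z =>
      le_csSup (((isCompact_closure_Theta m p n).image
        (f.continuous_eval.norm)).bddAbove) ⟨_, (thetaMap m p n z).2, rfl⟩
    refine ContinuousLinearMap.opNorm_le_bound _ hs0 fun x => ?_
    refine (sq_le_sq₀ (norm_nonneg _) (by positivity)).1 ?_
    rw [Submodule.coe_norm, Submodule.coe_norm, blockTuple_apply_coe, mul_pow, hnorm, hnorm,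
      ← integral_const_mul]
    refine integral_mono ((memLp_two_iff_integrable_sq_norm (hL2 _).1).1 (hL2 _))
      (((memLp_two_iff_integrable_sq_norm (hL2 _).1).1 (hL2 _)).const_mul _) fun z => ?_
    simp only [polyCalc_mul_apply, norm_mul, mul_pow]
    gcongr
    exact hle z

end Module

/-! ### Orbit sums and their isotypic decomposition. -/

section Orbit

variable {m p n : ℕ} [NeZero m] {H : Type*} [NormedAddCommGroup H] [InnerProductSpace ℂ H]
  [RKHS ℂ H (Polydisc n) ℂ]

/-- The sum of `|f|²` over the orbit. -/
def orbitSum (m p : ℕ) [NeZero m] (f : H) (z : Polydisc n) : ℝ :=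
  ∑ σ : reflectionGroup m p n, ‖f (act σ z)‖ ^ 2

lemma orbitSum_act (f : H) (σ : reflectionGroup m p n) (z : Polydisc n) :
    orbitSum m p f (act σ z) = orbitSum m p f z := by
  simp only [orbitSum, act_act]
  exact Equiv.sum_comp (Equiv.mulLeft σ) fun τ => ‖f (act τ z)‖ ^ 2

/-- Substitute τσ⁻¹ for τ and use unitarity of π. For k = l and z = w the right side becomes a sum
of squared moduli. -/
lemma sum_matrix_mul_sum_mul_conj {π : Irrep (reflectionGroup m p n)} (hu : π.IsUnitary)
    (k l : Fin π.deg) (h : H) (z w : Polydisc n) :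
    ∑ τ, π.matrix τ k l * ∑ σ : reflectionGroup m p n,
        h (act σ (act τ z)) * conj (h (act σ w)) =
      ∑ a, (∑ τ, π.matrix τ k a * h (act τ z)) * conj (∑ τ, π.matrix τ l a * h (act τ w)) := by
  have h1 : ∀ σ : reflectionGroup m p n,
      ∑ τ, π.matrix τ k l * h (act σ (act τ z)) =
        ∑ a, (∑ τ, π.matrix τ k a * h (act τ z)) * conj (π.matrix σ l a) := by
    intro σ
    rw [← Equiv.sum_comp (Equiv.mulRight σ⁻¹)]
    simp only [Equiv.coe_mulRight, act_act, inv_mul_cancel_right, π.matrix_mul, Matrix.mul_apply,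
      Irrep.matrix_inv_apply hu, Finset.sum_mul, RCLike.star_def]
    rw [Finset.sum_comm]
    exact Finset.sum_congr rfl fun a _ => Finset.sum_congr rfl fun τ _ => by ring
  calc _ = ∑ σ : reflectionGroup m p n,
        (∑ τ, π.matrix τ k l * h (act σ (act τ z))) * conj (h (act σ w)) := by
        simp only [Finset.mul_sum, Finset.sum_mul]
        rw [Finset.sum_comm]
        exact Finset.sum_congr rfl fun a _ => Finset.sum_congr rfl fun τ _ => by ring
    _ = _ := by
        rw [Finset.sum_congr rfl fun σ _ => (congrArg (· * _) (h1 σ)).trans (Finset.sum_mul _ _ _),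
          Finset.sum_comm]
        refine Finset.sum_congr rfl fun a _ => ?_
        rw [map_sum, Finset.mul_sum]
        refine Finset.sum_congr rfl fun σ _ => ?_
        rw [map_mul, mul_assoc]

end Orbit

/-! ### Inequivalence of tuples from different classes. -/

section Rigidity

variable {m p n : ℕ} [NeZero m]
variable {H : Type*} [NormedAddCommGroup H] [InnerProductSpace ℂ H] [CompleteSpace H]
  [RKHS ℂ H (Polydisc n) ℂ]

lemma AnalyticHilbertModule.continuous (A : AnalyticHilbertModule n H) (f : H) :
    Continuous fun z : Polydisc n => f z := by
  obtain ⟨F, hF, hfF⟩ := A.holomorphic f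
  have := continuousOn_iff_continuous_domRestrict.1 hF.continuousOn
  simpa [Set.domRestrict_def, ← hfF] using this

variable (hK : ∀ (σ : reflectionGroup m p n) (z w : Polydisc n),
  RKHS.kernel H (act σ z) (act σ w) = RKHS.kernel H z w)

lemma orbitSum_eq (f : H) (z : Polydisc n) :
    orbitSum m p f z = ∑ σ : reflectionGroup m p n, ‖compOp hK σ f z‖ ^ 2 := by
  simp [orbitSum, compOp_apply]

include hK in
lemma continuous_orbitSum (A : AnalyticHilbertModule n H) (f : H) :
    Continuous (orbitSum m p f : Polydisc n → ℝ) := by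
  rw [funext (orbitSum_eq hK f)]
  exact continuous_finsetSum _ fun σ _ => ((A.continuous (compOp hK σ f)).norm.pow 2)

include hK in
lemma integrable_orbitSum {μ : Measure (Polydisc n)}
    (hL2 : ∀ f : H, MemLp (fun z : Polydisc n => f z) 2 μ) (f : H) :
    Integrable (orbitSum m p f : Polydisc n → ℝ) μ := by
  rw [funext (orbitSum_eq hK f)]
  exact integrable_finsetSum _ fun σ _ => (memLp_two_iff_integrable_sq_norm (hL2 _).1).1 (hL2 _)

lemma compOp_polyCalc (A : AnalyticHilbertModule n H) (σ : reflectionGroup m p n)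
    (q : MvPolynomial (Fin n) ℂ) (f : H) :
    compOp hK σ (polyCalc (fun k => A.mul (theta m p n k)) q f) =
      polyCalc (fun k => A.mul (theta m p n k)) q (compOp hK σ f) :=
  map_polyCalc (compOp hK σ).toLinearMap (fun k x => compOp_mul_theta hK A σ k x) q f

include hK in
-- No G-invariance of μ is needed: `compOp hK σ` preserves the inner product of H, so every
-- translate of f contributes the same amount.
lemma integral_orbitSum_mul (A : AnalyticHilbertModule n H) {μ : Measure (Polydisc n)}
    (hL2 : ∀ f : H, MemLp (fun z : Polydisc n => f z) 2 μ)
    (hnorm : ∀ f : H, ‖f‖ ^ 2 = ∫ z, ‖f z‖ ^ 2 ∂μ) (f : H) (q r : MvPolynomial (Fin n) ℂ) :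
    ∫ z, (orbitSum m p f z : ℂ) * (eval (thetaMap m p n z : Fin n → ℂ) q *
        conj (eval (thetaMap m p n z : Fin n → ℂ) r)) ∂μ =
      Fintype.card (reflectionGroup m p n) *
        inner ℂ (polyCalc (fun k => A.mul (theta m p n k)) r f)
          (polyCalc (fun k => A.mul (theta m p n k)) q f) := by
  have h1 : ∀ σ : reflectionGroup m p n,
      inner ℂ (polyCalc (fun k => A.mul (theta m p n k)) r f)
        (polyCalc (fun k => A.mul (theta m p n k)) q f) =
      ∫ z, (‖compOp hK σ f z‖ ^ 2 : ℂ) * (eval (thetaMap m p n z : Fin n → ℂ) q *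
        conj (eval (thetaMap m p n z : Fin n → ℂ) r)) ∂μ := by
    intro σ
    rw [← inner_compOp_compOp hK σ, compOp_polyCalc, compOp_polyCalc,
      inner_eq_integral hL2 hnorm]
    refine integral_congr_ae (Filter.Eventually.of_forall fun z => ?_)
    simp only [polyCalc_mul_apply, map_mul]
    rw [← Complex.mul_conj']
    ring
  have hint : ∀ σ : reflectionGroup m p n, Integrable (fun z =>
      (‖compOp hK σ f z‖ ^ 2 : ℂ) * (eval (thetaMap m p n z : Fin n → ℂ) q *
        conj (eval (thetaMap m p n z : Fin n → ℂ) r))) μ := by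
    intro σ
    have := (hL2 (polyCalc (fun k => A.mul (theta m p n k)) q (compOp hK σ f))).integrable_mul
      (hL2 (polyCalc (fun k => A.mul (theta m p n k)) r (compOp hK σ f))).star
    refine this.congr (Filter.Eventually.of_forall fun z => ?_)
    simp only [Pi.mul_apply, Pi.star_apply, polyCalc_mul_apply, RCLike.star_def, map_mul]
    rw [← Complex.mul_conj']
    ring
  have h2 : ∀ z, (orbitSum m p f z : ℂ) * (eval (thetaMap m p n z : Fin n → ℂ) q *
        conj (eval (thetaMap m p n z : Fin n → ℂ) r)) =
      ∑ σ : reflectionGroup m p n, (‖compOp hK σ f z‖ ^ 2 : ℂ) *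
        (eval (thetaMap m p n z : Fin n → ℂ) q *
          conj (eval (thetaMap m p n z : Fin n → ℂ) r)) := by
    intro z
    rw [orbitSum_eq hK, ← Finset.sum_mul]
    push_cast
    rfl
  simp only [h2]
  rw [integral_finsetSum _ fun σ _ => hint σ, Finset.sum_congr rfl fun σ _ => (h1 σ).symm]
  simp

include hK in
-- Two applications of `ae_le_of_moments` give equality almost everywhere; the difference is
-- real-analytic, so the condition on μ removes the exceptional set.
lemma orbitSum_eq_of_inner_eq (hpm : p ∣ m) (A : AnalyticHilbertModule n H)
    {μ : Measure (Polydisc n)}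
    (hL2 : ∀ f : H, MemLp (fun z : Polydisc n => f z) 2 μ)
    (hnorm : ∀ f : H, ‖f‖ ^ 2 = ∫ z, ‖f z‖ ^ 2 ∂μ)
    (hμ : ∀ u : (Fin n → ℂ) → ℝ, AnalyticOnNhd ℝ u (polydisc n) →
      (∀ᵐ z : Polydisc n ∂μ, u z = 0) → ∀ z ∈ polydisc n, u z = 0) {f g : H}
    (hfg : ∀ q r : MvPolynomial (Fin n) ℂ,
      inner ℂ (polyCalc (fun k => A.mul (theta m p n k)) r f)
        (polyCalc (fun k => A.mul (theta m p n k)) q f) =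
      inner ℂ (polyCalc (fun k => A.mul (theta m p n k)) r g)
        (polyCalc (fun k => A.mul (theta m p n k)) q g)) (z : Polydisc n) :
    orbitSum m p f z = orbitSum m p g z := by
  have hmom : ∀ f g : H, (∀ q r : MvPolynomial (Fin n) ℂ,
      inner ℂ (polyCalc (fun k => A.mul (theta m p n k)) r f)
        (polyCalc (fun k => A.mul (theta m p n k)) q f) =
      inner ℂ (polyCalc (fun k => A.mul (theta m p n k)) r g)
        (polyCalc (fun k => A.mul (theta m p n k)) q g)) →
      ∀ᵐ z ∂μ, orbitSum m p f z ≤ orbitSum m p g z := fun f g hfg =>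
    ae_le_of_moments hpm (continuous_orbitSum hK A f) (continuous_orbitSum hK A g)
      (fun z => Finset.sum_nonneg fun _ _ => by positivity)
      (fun z => Finset.sum_nonneg fun _ _ => by positivity)
      (integrable_orbitSum hK hL2 f) (integrable_orbitSum hK hL2 g)
      (orbitSum_act f) (orbitSum_act g) fun q r => by
        rw [integral_orbitSum_mul hK A hL2 hnorm, integral_orbitSum_mul hK A hL2 hnorm, hfg]
  choose F hF hFe using A.holomorphic
  have han : ∀ h : H, AnalyticOnNhd ℝ (fun w => ‖F h w‖ ^ 2) (polydisc n) := by
    intro h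
    have h1 : AnalyticOnNhd ℝ (F h) (polydisc n) := (hF h).restrictScalars
    have hre : AnalyticOnNhd ℝ (fun w => (F h w).re) (polydisc n) :=
      Complex.reCLM.comp_analyticOnNhd h1
    have him : AnalyticOnNhd ℝ (fun w => (F h w).im) (polydisc n) :=
      Complex.imCLM.comp_analyticOnNhd h1
    refine ((hre.mul hre).add (him.mul him)).congr (isOpen_polydisc n) fun w _ => ?_
    simp [← Complex.normSq_eq_norm_sq, Complex.normSq_apply]
  have hu := hμ (fun w => (∑ σ : reflectionGroup m p n, ‖F (compOp hK σ f) w‖ ^ 2) -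
      ∑ σ : reflectionGroup m p n, ‖F (compOp hK σ g) w‖ ^ 2)
    ((Finset.univ.analyticOnNhd_fun_sum fun σ _ => han _).sub
      (Finset.univ.analyticOnNhd_fun_sum fun σ _ => han _)) (by
      filter_upwards [hmom f g hfg, hmom g f fun q r => (hfg q r).symm] with z h1 h2
      simp only [← hFe, ← orbitSum_eq hK]
      exact sub_eq_zero.2 (le_antisymm h1 h2)) z z.2
  simp only [← hFe, ← orbitSum_eq hK] at hu
  exact sub_eq_zero.1 hu

include hK in
lemma sum_mul_conj_eq_of_orbitSum_eq (A : AnalyticHilbertModule n H) {f g : H}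
    (h : ∀ z : Polydisc n, orbitSum m p f z = orbitSum m p g z) (z w : Polydisc n) :
    ∑ σ : reflectionGroup m p n, f (act σ z) * conj (f (act σ w)) =
      ∑ σ : reflectionGroup m p n, g (act σ z) * conj (g (act σ w)) := by
  choose F hF hFe using A.holomorphic
  -- The difference of the two sums is a single sum over G ⊕ G, with the minus sign placed in the
  -- conjugated factor.
  have key := sum_mul_conj_eq_zero_of_diagonal_polydisc (n := n)
    (ι := reflectionGroup m p n ⊕ reflectionGroup m p n)
    (F := Sum.elim (fun σ => F (compOp hK σ f)) fun σ => F (compOp hK σ g))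
    (G := Sum.elim (fun σ => F (compOp hK σ f)) fun σ => -F (compOp hK σ g))
    (by rintro (σ | σ) <;> exact (hF _).differentiableOn)
    (by
      rintro (σ | σ)
      · exact (hF _).differentiableOn
      · exact (hF _).differentiableOn.neg)
    (by
      intro z hz
      have h1 := h ⟨z, hz⟩
      rw [orbitSum_eq hK, orbitSum_eq hK] at h1
      simp only [hFe] at h1
      have h2 := congrArg (fun x : ℝ => (x : ℂ)) h1
      push_cast at h2
      simp only [← Complex.mul_conj'] at h2
      simp [Fintype.sum_sum_type, h2]) z.2 w.2
  simp only [Fintype.sum_sum_type, Sum.elim_inl, Sum.elim_inr, Pi.neg_apply, map_neg, mul_neg,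
    Finset.sum_neg_distrib, ← hFe, compOp_apply] at key
  exact add_neg_eq_zero.1 key

lemma isotypicOp_apply_eq_zero_iff (π : Irrep (reflectionGroup m p n)) (i j : Fin π.deg) (f : H)
    (z : Polydisc n) :
    isotypicOp hK π i j f z = 0 ↔ ∑ σ, π.matrix σ j i * f (act σ z) = 0 := by
  have hd : (π.deg : ℂ) ≠ 0 := by exact_mod_cast π.deg_pos.ne'
  have hG : (Fintype.card (reflectionGroup m p n) : ℂ) ≠ 0 := by
    exact_mod_cast Fintype.card_ne_zero
  rw [isotypicOp_apply, mul_eq_zero]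
  exact or_iff_right (div_ne_zero hd hG)

include hK in
-- Project the polarised identity onto π' and set w = z. The f side vanishes because f has no
-- π'-component; on the g side every square must vanish, and the one with a = j is a multiple of
-- |g(z)|².
lemma eq_zero_of_orbitSum_eq (A : AnalyticHilbertModule n H)
    {π π' : Irrep (reflectionGroup m p n)} (hne : π.toDual ≠ π'.toDual) (hu : π'.IsUnitary)
    {i : Fin π.deg} {j : Fin π'.deg} {f g : H} (hf : f ∈ block H π i) (hg : g ∈ block H π' j)
    (h : ∀ z : Polydisc n, orbitSum m p f z = orbitSum m p g z) : g = 0 := by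
  have hf0 : ∀ k l, isotypicOp hK π' k l f = 0 := fun k l => by
    rw [← (mem_block_iff hK π i f).1 hf, ← mul_apply_eq_comp, isotypicOp_mul_of_ne hK hne.symm,
      zero_apply]
  apply RKHS.ext
  intro z
  rw [← (mem_block_iff hK π' j g).1 hg, RKHS.coe_zero, Pi.zero_apply,
    isotypicOp_apply_eq_zero_iff]
  have h1 := sum_matrix_mul_sum_mul_conj hu j j g z z
  simp only [← sum_mul_conj_eq_of_orbitSum_eq hK A h] at h1
  rw [sum_matrix_mul_sum_mul_conj hu j j f z z, Finset.sum_eq_zero] at h1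
  · simp only [Complex.mul_conj] at h1
    have h2 : ∑ a, Complex.normSq (∑ τ, π'.matrix τ j a * g (act τ z)) = 0 := by
      exact_mod_cast h1.symm
    rw [Finset.sum_eq_zero_iff_of_nonneg fun _ _ => Complex.normSq_nonneg _] at h2
    exact Complex.normSq_eq_zero.1 (h2 j (Finset.mem_univ _))
  · intro a _
    rw [(isotypicOp_apply_eq_zero_iff hK π' a j f z).1 (by rw [hf0]; simp), zero_mul]

include hK in
lemma not_unitarilyEquivalent_blockTuple (hpm : p ∣ m) (A : AnalyticHilbertModule n H)
    {μ : Measure (Polydisc n)}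
    (hL2 : ∀ f : H, MemLp (fun z : Polydisc n => f z) 2 μ)
    (hnorm : ∀ f : H, ‖f‖ ^ 2 = ∫ z, ‖f z‖ ^ 2 ∂μ)
    (hμ : ∀ u : (Fin n → ℂ) → ℝ, AnalyticOnNhd ℝ u (polydisc n) →
      (∀ᵐ z : Polydisc n ∂μ, u z = 0) → ∀ z ∈ polydisc n, u z = 0)
    {π π' : Irrep (reflectionGroup m p n)} (hne : π.toDual ≠ π'.toDual) (hu : π'.IsUnitary)
    (i : Fin π.deg) (j : Fin π'.deg) :
    ¬ UnitarilyEquivalent (blockTuple A π i) (blockTuple A π' j) := by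
  rintro ⟨U, hU⟩
  obtain ⟨f, hf, hf0⟩ := Submodule.exists_mem_ne_zero_of_ne_bot (block_ne_bot hK A π i)
  have hUq : ∀ (q : MvPolynomial (Fin n) ℂ) (x : block H π i),
      U (polyCalc (blockTuple A π i) q x) = polyCalc (blockTuple A π' j) q (U x) :=
    fun q x => map_polyCalc U.toLinearEquiv.toLinearMap hU q x
  have h0 : ((U ⟨f, hf⟩ : block H π' j) : H) = 0 := by
    refine eq_zero_of_orbitSum_eq hK A hne hu hf (U ⟨f, hf⟩).2
      (orbitSum_eq_of_inner_eq hK hpm A hL2 hnorm hμ fun q r => ?_)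
    rw [← blockTuple_apply_coe A π' j, ← blockTuple_apply_coe A π' j, ← hUq, ← hUq,
      ← Submodule.coe_inner, U.inner_map_map, Submodule.coe_inner, blockTuple_apply_coe,
      blockTuple_apply_coe]
  have h1 : (⟨f, hf⟩ : block H π i) = 0 := U.injective (by rw [map_zero]; exact Subtype.ext h0)
  exact hf0 (congrArg Subtype.val h1)

end Rigidity

end ThetaContraction

end

/-! ### Assembly: pairwise distinctness and the count of equivalence classes. -/

open ThetaContraction MeasureTheory in
theorem mainTheorem2 (m p n : ℕ) [NeZero m] (hpm : p ∣ m) (hn : 1 < n)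
    {H : Type*} [NormedAddCommGroup H] [InnerProductSpace ℂ H] [CompleteSpace H]
    [RKHS ℂ H (Polydisc n) ℂ] (A : AnalyticHilbertModule n H)
    -- the reproducing kernel is invariant under the group
    (hK : ∀ (σ : reflectionGroup m p n) (z w : Polydisc n),
      RKHS.kernel H (act σ z) (act σ w) = RKHS.kernel H z w)
    -- `H` is contained in `L²(𝔻ⁿ, μ)` as a Hilbert space
    (μ : Measure (Polydisc n))
    (hL2 : ∀ f : H, MemLp (fun z : Polydisc n => f z) 2 μ)
    (hnorm : ∀ f : H, ‖f‖ ^ 2 = ∫ z, ‖f z‖ ^ 2 ∂μ)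
    -- `μ` is not carried by the zero set of a nonzero real-analytic function
    (hμ : ∀ u : (Fin n → ℂ) → ℝ, AnalyticOnNhd ℝ u (polydisc n) →
      (∀ᵐ z : Polydisc n ∂μ, u z = 0) → ∀ z ∈ polydisc n, u z = 0)
    -- a unitary representative of each class of irreducible representations
    (π : Dual (reflectionGroup m p n) → Irrep (reflectionGroup m p n))
    (hπ : ∀ ϱ, (π ϱ).toDual = ϱ) (hunitary : ∀ ϱ, (π ϱ).IsUnitary) :
    -- each `ℙ^{ii} H` is a nonzero closed subspace on which the tuple is a `Θₙ`-contraction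
    (∀ ϱ (i : Fin (π ϱ).deg),
      (∀ f : H, ∃ h : H, (h : Polydisc n → ℂ) = isotypicMap (π ϱ) i i f) ∧
      IsClosed (block H (π ϱ) i : Set H) ∧ block H (π ϱ) i ≠ ⊥ ∧
      IsThetaContraction m p (blockTuple A (π ϱ) i)) ∧
    -- the subspaces are pairwise distinct
    Function.Injective (fun x : (Σ ϱ, Fin (π ϱ).deg) => block H (π x.1) x.2) ∧
    -- two of the tuples are unitarily equivalent exactly when they belong to the same class
    (∀ ϱ ϱ' (i : Fin (π ϱ).deg) (j : Fin (π ϱ').deg),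
      UnitarilyEquivalent (blockTuple A (π ϱ) i) (blockTuple A (π ϱ') j) ↔ ϱ = ϱ') ∧
    -- the number of families, and the size of each family
    Finite (Dual (reflectionGroup m p n)) ∧
    {C : Set (Σ ϱ, Fin (π ϱ).deg) | ∃ x : (Σ ϱ, Fin (π ϱ).deg), C = {y | UnitarilyEquivalent
      (blockTuple A (π x.1) x.2) (blockTuple A (π y.1) y.2)}}.ncard =
        Nat.card (Dual (reflectionGroup m p n)) ∧
    (∀ x : (Σ ϱ, Fin (π ϱ).deg), {y : (Σ ϱ, Fin (π ϱ).deg) | UnitarilyEquivalent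
      (blockTuple A (π x.1) x.2) (blockTuple A (π y.1) y.2)}.ncard = (π x.1).deg) := by
  have hne : ∀ {ϱ ϱ'}, ϱ ≠ ϱ' → (π ϱ).toDual ≠ (π ϱ').toDual := fun h => by rwa [hπ, hπ]
  have hequiv : ∀ ϱ ϱ' (i : Fin (π ϱ).deg) (j : Fin (π ϱ').deg),
      UnitarilyEquivalent (blockTuple A (π ϱ) i) (blockTuple A (π ϱ') j) ↔ ϱ = ϱ' := by
    intro ϱ ϱ' i j
    constructor
    · intro h
      by_contra hc
      exact not_unitarilyEquivalent_blockTuple hK hpm A hL2 hnorm hμ (hne hc) (hunitary ϱ') i j h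
    · rintro rfl
      exact unitarilyEquivalent_blockTuple hK A (hunitary ϱ) i j
  have hset : ∀ x : (Σ ϱ, Fin (π ϱ).deg), {y : (Σ ϱ, Fin (π ϱ).deg) | UnitarilyEquivalent
      (blockTuple A (π x.1) x.2) (blockTuple A (π y.1) y.2)} = {y | x.1 = y.1} := fun x =>
    Set.ext fun y => hequiv _ _ _ _
  refine ⟨fun ϱ i => ⟨fun f => ⟨isotypicOp hK (π ϱ) i i f, coe_isotypicOp hK (π ϱ) i i f⟩,
    isClosed_block hK (π ϱ) i, block_ne_bot hK A (π ϱ) i,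
    isThetaContraction_blockTuple A hL2 hnorm (π ϱ) i⟩, ?_, hequiv, finite_dual, ?_, ?_⟩
  · rintro ⟨ϱ, i⟩ ⟨ϱ', j⟩ h
    simp only at h
    by_cases hϱ : ϱ = ϱ'
    · subst hϱ
      by_cases hij : i = j
      · rw [hij]
      · have hd := disjoint_block_of_index_ne (H := H) hK (π ϱ) hij
        rw [← h, disjoint_self] at hd
        exact (block_ne_bot hK A (π ϱ) i hd).elim
    · have hd := disjoint_block_of_ne (H := H) hK (hne hϱ) i j
      rw [← h, disjoint_self] at hd
      exact (block_ne_bot hK A (π ϱ) i hd).elim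
  · simp only [hset]
    -- The equivalence classes are the fibres over the dual; each is nonempty since degrees are
    -- positive, so distinct ϱ give distinct fibres.
    have hrange : {C : Set (Σ ϱ, Fin (π ϱ).deg) | ∃ x : (Σ ϱ, Fin (π ϱ).deg),
        C = {y | x.1 = y.1}} =
        Set.range fun (ϱ : Dual (reflectionGroup m p n)) =>
          {y : (Σ ϱ, Fin (π ϱ).deg) | ϱ = y.1} := by
      ext C
      constructor
      · rintro ⟨x, rfl⟩
        exact ⟨x.1, rfl⟩
      · rintro ⟨ϱ, rfl⟩
        exact ⟨⟨ϱ, ⟨0, (π ϱ).deg_pos⟩⟩, rfl⟩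
    rw [hrange, ← Set.image_univ, Set.ncard_image_of_injective, Set.ncard_univ]
    intro ϱ ϱ' h
    have h1 : (⟨ϱ, ⟨0, (π ϱ).deg_pos⟩⟩ : Σ ϱ, Fin (π ϱ).deg) ∈
        {y : (Σ ϱ, Fin (π ϱ).deg) | ϱ' = y.1} := by
      rw [← show {y : (Σ ϱ, Fin (π ϱ).deg) | ϱ = y.1} = {y | ϱ' = y.1} from h]
      rfl
    exact Eq.symm h1
  · rintro ⟨ϱ, i⟩
    rw [hset]
    have hrange : {y : (Σ ϱ, Fin (π ϱ).deg) | ϱ = y.1} =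
        Set.range fun j : Fin (π ϱ).deg => (⟨ϱ, j⟩ : Σ ϱ, Fin (π ϱ).deg) := by
      ext ⟨ϱ', j⟩
      constructor
      · rintro rfl
        exact ⟨j, rfl⟩
      · rintro ⟨j, hj⟩
        exact congrArg Sigma.fst hj
    rw [hrange, ← Set.image_univ]
    exact (Set.ncard_image_of_injective _ sigma_mk_injective).trans
      (by rw [Set.ncard_univ, Nat.card_fin])
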